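/- **Conventions.** Linear spaces are finite-dimensional over $\mathbb{Q}$. LIA formulas are built from $t_1\le t_2$ and $n\mid t$ (with $n\in\mathbb{Z}$ and $t$ an integer-coefficient affine term) by $\land,\lor,\lnot,\exists,\forall$; $F\models G$ means that every integer valuation satisfying $F$ satisfies $G$. A transition formula $F(X,X')$ is an LIA formula over a finite set $X$ of variables and its primed copies; it defines the transition system with state space $X\to\mathbb{Q}$ and transitions $v\to v'$ for integer-valued $v,v'$ with $[v,v']\models F$. **Transition systems.** A transition system $T=\langle S_T,R_T\rangle$ has a linear space $S_T$ as state space, and is linear (affine) if $R_T$ is a linear (possibly empty affine) subspace of $S_T\times S_T$. Its $\omega$-domain $\mathrm{dom}^\omega(T)$ is the set of states that start an infinite computation. A linear simulation $s:T\to U$ is a linear map with $x\to_T x'\Rightarrow s(x)\to_U s(x')$. If $T$ is deterministic and linear, then $T|_\omega$ denotes the linear successor map on $\mathrm{dom}^\omega(T)$, and $T$ has rational spectrum if all complex roots of the characteristic polynomial of $T|_\omega$ are rational. The homogenization of an affine $V$ has state space $S_V\times\mathbb{Q}$ and as transition relation the span of $\{((x,1),(x',1)) : x\to_V x'\}$.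 A $\mathbb{Q}$-DATS is a deterministic affine transition system whose homogenization is deterministic with rational spectrum. A $\mathbb{Q}$-DATS-reflection of $T$ is a $\mathbb{Q}$-DATS $V$ with a linear simulation $s:T\to V$ such that each linear simulation from $T$ to a $\mathbb{Q}$-DATS $W$ factors as $\bar t\circ s$ for a unique linear simulation $\bar t:V\to W$. **Characteristic sequences.** Let $A\in\mathbb{Q}^{q\times q}$ have integer spectrum and let $G(w)$ be an LIA formula over $q$ variables. Choose a quantifier-free $G'$ equivalent to $G$ at all $w\in\mathbb{Q}^q$ (at rational points quantifiers range over $\mathbb{Z}$ and $n\mid t$ means $t\in n\mathbb{Z}$). The periodic sequence $\chi(G,A)=\chi(G',A)$ is defined by recursion on $G'$, pointwise for $\land,\lor,\lnot$. For $t_1\le t_2$ its even (odd) entries are $\mathsf{DTA}(p)$, where $\frac1Q p(x,k)$ with an integer $Q>0$ is a closed form, for all large $k$, of $(t_2-t_1)(A^{2k}x)$ (of $(t_2-t_1)(A^{2k+1}x)$). Here $p=\sum_i\lambda_i^kk^{d_i}a_i(x)$ with integers $\lambda_i>0$, $d_i\in\mathbb{N}$, integer affine terms $a_i$, and the pairs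 $(\lambda_i,d_i)$ strictly decreasing lexicographically; $\mathsf{DTA}(0)=\mathit{true}$ and $\mathsf{DTA}(\lambda^kk^da+p)=(a\ge1)\lor(a=0\land\mathsf{DTA}(p))$. For $n\mid t$ the $k$-th entry is $Qn\mid\sum_i z_{i,k}a_i(x)$, where $\frac1Q\sum_i\lambda_i^kk^{d_i}a_i(x)$ is a closed form of $t(A^kx)$ for all large $k$ (with $\lambda_i\in\mathbb{Z}$) and $(z_{i,k})_k$ is a periodic integer sequence that equals $\lambda_i^kk^{d_i}\bmod Qn$ for all but finitely many $k$. **Mortal precondition.** Given $F(X,X')$, choose a $\mathbb{Q}$-DATS-reflection $\langle V,s\rangle$ of $F$, and let $T$ be the homogenization of $V$ and $t(x)=(s(x),1)$. Let $\mathbb{Z}(T)$ be the span of the generalized eigenvectors of $T|_\omega$ for integer eigenvalues, and let $T_{\mathbb{Z}}$ be the restriction of $T|_\omega$ to it. Choose a linear projection $p$ of $S_T$ onto $\mathbb{Z}(T)$ and a matrix $C$ with $Cy=0\iff y\in\mathbb{Z}(T)$, with coordinates on $S_T$ and $\mathbb{Z}(T)$ in which $t$, $p$, $C$ have integer entries.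 Let $G(w)$ be an LIA formula expressing, for rational $w$, $\exists x,x'.\,F(x,x')\land w=p(t(x))\land C\,t(x)=0$ (with $x,x'$ integral), and let $(H_0,\dots,H_P)^\omega=\chi(G,T_{\mathbb{Z}})$. Then $$\mathrm{mp}(F)\;=\;\lnot\Bigl(\bigwedge_{i=0}^{P}H_i(p(t(x)))\;\land\;C\,t(x)=0\Bigr).$$ **Theorem (Monotonicity).** Every transition formula $F$ has a mortal precondition $\mathrm{mp}(F)$, and for all transition formulas $F_1,F_2$ over the same variables with $F_1\models F_2$, we have $\mathrm{mp}(F_2)\models\mathrm{mp}(F_1)$, whichever choices are made in computing $\mathrm{mp}(F_1)$ and $\mathrm{mp}(F_2)$. -/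

import Mathlib

open scoped Matrix

/-! ## Linear integer arithmetic -/

namespace LIA

/-- Terms `t ::= x | n | n · t | t₁ + t₂` over a set `X` of variables. -/
inductive Term (X : Type) : Type
  | var (x : X) : Term X
  | const (n : ℤ) : Term X
  | smul (n : ℤ) (t : Term X) : Term X
  | add (t₁ t₂ : Term X) : Term X

namespace Term

/-- Value of a term at a valuation of its variables in a ring. -/
def eval {X R : Type} [Ring R] (v : X → R) : Term X → R
  | var x => v x
  | const n => (n : R)
  | smul n t => (n : R) * eval v t
  | add t₁ t₂ => eval v t₁ + eval v t₂

/-- Substitution of terms for variables. -/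
def subst {X Y : Type} (σ : X → Term Y) : Term X → Term Y
  | var x => σ x
  | const n => const n
  | smul n t => smul n (subst σ t)
  | add t₁ t₂ => add (subst σ t₁) (subst σ t₂)

/-- The sum of a list of terms. -/
def sum {X : Type} : List (Term X) → Term X
  | [] => const 0
  | t :: l => add t (sum l)

end Term

/-- Formulas of linear integer arithmetic whose free variables range over `X`. A quantifier binds
the variable `none` of a formula over `Option X`. -/
inductive Formula : Type → Type 1
  | le {X : Type} (t₁ t₂ : Term X) : Formula X
  | dvd {X : Type} (n : ℤ) (t : Term X) : Formula X
  | and {X : Type} (φ ψ : Formula X) : Formula X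
  | or {X : Type} (φ ψ : Formula X) : Formula X
  | not {X : Type} (φ : Formula X) : Formula X
  | ex {X : Type} (φ : Formula (Option X)) : Formula X
  | all {X : Type} (φ : Formula (Option X)) : Formula X

namespace Formula

/-- Truth of a formula at a valuation `v` of its free variables in an ordered ring `R`. Quantified
variables always range over the integers, and `n ∣ t` means that `t` is an integer multiple of `n`.
For `R = ℤ` this is truth in the standard model of the integers; `R = ℚ` is used to evaluate
formulas at rational vectors. -/
def Holds {R : Type} [Ring R] [LE R] : {X : Type} → Formula X → (X → R) → Prop
  | _, le t₁ t₂, v => t₁.eval v ≤ t₂.eval v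
  | _, dvd n t, v => ∃ z : ℤ, t.eval v = (n : R) * (z : R)
  | _, and φ ψ, v => φ.Holds v ∧ ψ.Holds v
  | _, or φ ψ, v => φ.Holds v ∨ ψ.Holds v
  | _, not φ, v => ¬ φ.Holds v
  | _, ex φ, v => ∃ z : ℤ, φ.Holds (fun o => o.elim (z : R) v)
  | _, all φ, v => ∀ z : ℤ, φ.Holds (fun o => o.elim (z : R) v)

/-- `v ⊨ φ` for an (integer) valuation `v`. -/
def Sat {X : Type} (φ : Formula X) (v : X → ℤ) : Prop := φ.Holds v

/-- `φ ⊨ ψ`: every valuation that satisfies `φ` satisfies `ψ`. -/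
def Entails {X : Type} (φ ψ : Formula X) : Prop := ∀ v : X → ℤ, φ.Sat v → ψ.Sat v

/-- Substitution of terms for the free variables. -/
def subst : {X Y : Type} → (X → Term Y) → Formula X → Formula Y
  | _, _, σ, le t₁ t₂ => le (t₁.subst σ) (t₂.subst σ)
  | _, _, σ, dvd n t => dvd n (t.subst σ)
  | _, _, σ, and φ ψ => and (subst σ φ) (subst σ ψ)
  | _, _, σ, or φ ψ => or (subst σ φ) (subst σ ψ)
  | _, _, σ, not φ => not (subst σ φ)
  | _, _, σ, ex φ => ex (subst
      (fun o => o.elim (Term.var none) (fun x => (σ x).subst (fun y => Term.var (some y)))) φ)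
  | _, _, σ, all φ => all (subst
      (fun o => o.elim (Term.var none) (fun x => (σ x).subst (fun y => Term.var (some y)))) φ)

/-- The formula `true`. -/
def verum {X : Type} : Formula X := le (Term.const 0) (Term.const 0)

/-- The formula `t = 0`. -/
def eqZero {X : Type} (t : Term X) : Formula X :=
  and (le t (Term.const 0)) (le (Term.const 0) t)

/-- The conjunction of a list of formulas. -/
def conj {X : Type} : List (Formula X) → Formula X
  | [] => verum
  | φ :: l => and φ (conj l)

end Formula

/-! ### Characteristic sequences -/

/-- An integer exponential-polynomial term `∑ᵢ λᵢ ^ k * k ^ dᵢ * aᵢ(x)`: the list of the summands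
`(λᵢ, dᵢ, aᵢ)`, where `aᵢ` is an (affine) term over the variables `x`. -/
abbrev ExpPoly (X : Type) : Type := List (ℤ × ℕ × Term X)

namespace ExpPoly

/-- The value of an exponential-polynomial at `x` and `k`. -/
def eval {X : Type} (p : ExpPoly X) (x : X → ℚ) (k : ℕ) : ℚ :=
  (p.map (fun s => (s.1 : ℚ) ^ k * (k : ℚ) ^ s.2.1 * s.2.2.eval x)).sum

/-- All bases are positive, and the summands are listed in the order of strictly decreasing
asymptotic growth. -/
def IsDominanceOrdered {X : Type} (p : ExpPoly X) : Prop :=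
  (∀ s ∈ p, 0 < s.1) ∧
    p.Pairwise (fun s s' => s'.1 < s.1 ∨ (s.1 = s'.1 ∧ s'.2.1 < s.2.1))

/-- Dominant term analysis. -/
def dta {X : Type} : ExpPoly X → Formula X
  | [] => Formula.verum
  | s :: p => Formula.or (Formula.le (Term.const 1) s.2.2)
      (Formula.and (Formula.eqZero s.2.2) (dta p))

/-- `(1 / Q) * p(x, k)` is a closed form of `t (B k * x)`, for all large enough `k`. -/
def IsClosedForm {q : ℕ} (B : ℕ → Matrix (Fin q) (Fin q) ℚ) (t : Term (Fin q)) (Q : ℕ)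
    (p : ExpPoly (Fin q)) : Prop :=
  0 < Q ∧ ∃ K : ℕ, ∀ k ≥ K, ∀ x : Fin q → ℚ, t.eval (B k *ᵥ x) = 1 / (Q : ℚ) * p.eval x k

end ExpPoly

/-- A sequence is periodic if it is of the form `(a₀, …, a_P)^ω`. -/
def HasPeriod {α : Type*} (a : ℕ → α) (P : ℕ) : Prop := ∀ k, a (k + (P + 1)) = a k

/-- The characteristic sequences of a quantifier-free formula with respect to the matrix `A`, by
recursion on the formula. -/
inductive CharSeq {q : ℕ} (A : Matrix (Fin q) (Fin q) ℚ) :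
    Formula (Fin q) → (ℕ → Formula (Fin q)) → Prop
  /-- For `t₁ ≤ t₂`, written as `t₂ - t₁ ≥ 0`: dominant term analysis of the closed forms of
  `(t₂ - t₁) (A ^ (2 k) * x)` and `(t₂ - t₁) (A ^ (2 k + 1) * x)`. -/
  | le (t₁ t₂ : Term (Fin q)) (Qe Qo : ℕ) (pe po : ExpPoly (Fin q))
      (he : ExpPoly.IsClosedForm (fun k => A ^ (2 * k)) (t₂.add (t₁.smul (-1))) Qe pe)
      (ho : ExpPoly.IsClosedForm (fun k => A ^ (2 * k + 1)) (t₂.add (t₁.smul (-1))) Qo po)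
      (he' : pe.IsDominanceOrdered) (ho' : po.IsDominanceOrdered) :
      CharSeq A (Formula.le t₁ t₂) (fun k => if Even k then pe.dta else po.dta)
  /-- For `n ∣ t`: in the closed form of `t (A ^ k * x)`, each `λᵢ ^ k * k ^ dᵢ` is replaced by a
  periodic sequence which agrees with its residue modulo `Q n` for all but finitely many `k`. -/
  | dvd (n : ℤ) (t : Term (Fin q)) (Q : ℕ) (p : ExpPoly (Fin q))
      (hp : ExpPoly.IsClosedForm (fun k => A ^ k) t Q p)
      (z : Fin p.length → ℕ → ℤ) (hz : ∀ i, ∃ P, HasPeriod (z i) P)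
      (hz' : ∀ i, ∃ K, ∀ k ≥ K,
        z i k = ((p.get i).1 ^ k * (k : ℤ) ^ (p.get i).2.1) % ((Q : ℤ) * n)) :
      CharSeq A (Formula.dvd n t) (fun k => Formula.dvd ((Q : ℤ) * n)
        (Term.sum (List.ofFn (fun i => Term.smul (z i k) (p.get i).2.2))))
  | and (φ ψ : Formula (Fin q)) (H H' : ℕ → Formula (Fin q)) (h : CharSeq A φ H)
      (h' : CharSeq A ψ H') : CharSeq A (φ.and ψ) (fun k => (H k).and (H' k))
  | or (φ ψ : Formula (Fin q)) (H H' : ℕ → Formula (Fin q)) (h : CharSeq A φ H)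
      (h' : CharSeq A ψ H') : CharSeq A (φ.or ψ) (fun k => (H k).or (H' k))
  | not (φ : Formula (Fin q)) (H : ℕ → Formula (Fin q)) (h : CharSeq A φ H) :
      CharSeq A φ.not (fun k => (H k).not)

/-- `H` is a characteristic sequence `χ(G, A)`: it is obtained by the recursion above from a
quantifier-free formula `G'` (the recursion has no case for quantifiers) that is equivalent to `G`
on rational vectors, which is where `G` is evaluated along the orbits of the rational matrix `A`. -/
def IsCharSeq {q : ℕ} (G : Formula (Fin q)) (A : Matrix (Fin q) (Fin q) ℚ)
    (H : ℕ → Formula (Fin q)) : Prop :=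
  ∃ G' : Formula (Fin q), (∀ w : Fin q → ℚ, G'.Holds w ↔ G.Holds w) ∧ CharSeq A G' H

end LIA

/-! ## Transition systems -/

/-- A transition system whose state space is a finite-dimensional rational linear space. -/
structure TransitionSystem where
  State : Type
  [addCommGroup : AddCommGroup State]
  [module : Module ℚ State]
  [finiteDimensional : FiniteDimensional ℚ State]
  Rel : Set (State × State)

namespace TransitionSystem

attribute [instance] TransitionSystem.addCommGroup TransitionSystem.module
  TransitionSystem.finiteDimensional

variable (T U : TransitionSystem)

/-- `dom^ω(T)`: the states from which there is an infinite computation. -/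
def omegaDomain : Set T.State :=
  {x | ∃ y : ℕ → T.State, y 0 = x ∧ ∀ k, (y k, y (k + 1)) ∈ T.Rel}

/-- The transition relation is a linear subspace. -/
def IsLinear : Prop :=
  ∃ L : Submodule ℚ (T.State × T.State), (L : Set (T.State × T.State)) = T.Rel

/-- The transition relation is a (possibly empty) affine subspace. -/
def IsAffine : Prop :=
  ∃ L : AffineSubspace ℚ (T.State × T.State), (L : Set (T.State × T.State)) = T.Rel

def IsDeterministic : Prop :=
  ∀ x y z, (x, y) ∈ T.Rel → (x, z) ∈ T.Rel → y = z

/-- Linear simulations. -/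
def IsSimulation (s : T.State →ₗ[ℚ] U.State) : Prop :=
  ∀ x x', (x, x') ∈ T.Rel → (s x, s x') ∈ U.Rel

/-- `⟨U, s⟩` is a reflection of `T` in the class `C` of transition systems (and linear
simulations). -/
def IsReflection (C : TransitionSystem → Prop) (s : T.State →ₗ[ℚ] U.State) : Prop :=
  C U ∧ T.IsSimulation U s ∧
    ∀ (V : TransitionSystem) (t : T.State →ₗ[ℚ] V.State), C V → T.IsSimulation V t →
      ∃! t' : U.State →ₗ[ℚ] V.State, U.IsSimulation V t' ∧ t' ∘ₗ s = t

/-- The homogenization of `T`: its transitions are the linear combinations of the pairs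
`((x, 1), (x', 1))` with `x → x'`; see `mem_homog_iff`. -/
def homog : TransitionSystem where
  State := T.State × ℚ
  Rel := Submodule.span ℚ ((fun r : T.State × T.State => ((r.1, (1 : ℚ)), (r.2, (1 : ℚ)))) '' T.Rel)

variable {T U}

/-- For an affine transition system with a transition `x₀ → x₀'`, the transitions of the
homogenization are the pairs `((x, c), (x', c))` with `x + (1 - c) x₀ → x' + (1 - c) x₀'`. -/
theorem mem_homog_iff (hT : T.IsAffine) {x₀ x₀' : T.State} (h₀ : (x₀, x₀') ∈ T.Rel)
    (x x' : T.State) (c c' : ℚ) :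
    ((x, c), (x', c')) ∈ T.homog.Rel ↔
      c = c' ∧ (x + (1 - c) • x₀, x' + (1 - c) • x₀') ∈ T.Rel := by
  obtain ⟨L, hL⟩ := hT
  have key : ∀ (y y' : T.State) (d : ℚ), (y + (1 - d) • x₀, y' + (1 - d) • x₀') ∈ T.Rel ↔
      (y - d • x₀, y' - d • x₀') ∈ L.direction := by
    intro y y' d
    rw [← hL] at h₀ ⊢
    rw [← AffineSubspace.vadd_mem_iff_mem_direction _ h₀, SetLike.mem_coe]
    have : (y + (1 - d) • x₀, y' + (1 - d) • x₀') =
        (y - d • x₀, y' - d • x₀') +ᵥ ((x₀, x₀') : T.State × T.State) := by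
      ext <;> simp only [vadd_eq_add, Prod.mk_add_mk, sub_smul, one_smul] <;> abel
    rw [this]
  rw [key]
  constructor
  · intro h
    have h' : ((x, c), (x', c')) ∈ Submodule.span ℚ
      ((fun r : T.State × T.State => ((r.1, (1 : ℚ)), (r.2, (1 : ℚ)))) '' T.Rel) := h
    have := Submodule.span_induction (p := fun r _ => r.1.2 = r.2.2 ∧
      (r.1.1 - r.1.2 • x₀, r.2.1 - r.1.2 • x₀') ∈ L.direction) ?_ ?_ ?_ ?_ h'
    · exact this
    · rintro _ ⟨⟨y, y'⟩, hy, rfl⟩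
      refine ⟨rfl, ?_⟩
      rw [← key]
      simpa using hy
    · refine ⟨rfl, ?_⟩
      convert L.direction.zero_mem using 1
      ext <;> simp
    · rintro ⟨⟨a, b⟩, ⟨a', b'⟩⟩ ⟨⟨e, f⟩, ⟨e', f'⟩⟩ - - ⟨h1, h2⟩ ⟨h3, h4⟩
      dsimp only at h1 h2 h3 h4
      subst h1 h3
      refine ⟨rfl, ?_⟩
      have h5 := L.direction.add_mem h2 h4
      convert h5 using 1
      ext <;> simp only [Prod.mk_add_mk, add_smul] <;> abel
    · rintro g ⟨⟨a, b⟩, ⟨a', b'⟩⟩ - ⟨h1, h2⟩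
      dsimp only at h1 h2
      subst h1
      refine ⟨rfl, ?_⟩
      have h5 := L.direction.smul_mem g h2
      convert h5 using 1
      ext <;> simp only [Prod.smul_mk, smul_sub, smul_smul, smul_eq_mul]
  · rintro ⟨rfl, h⟩
    rw [← key] at h
    have h1 : (((x + (1 - c) • x₀, 1), (x' + (1 - c) • x₀', 1)) :
        (T.State × ℚ) × (T.State × ℚ)) ∈ Submodule.span ℚ
      ((fun r : T.State × T.State => ((r.1, (1 : ℚ)), (r.2, (1 : ℚ)))) '' T.Rel) :=
      Submodule.subset_span ⟨_, h, rfl⟩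
    have h2 : (((x₀, 1), (x₀', 1)) : (T.State × ℚ) × (T.State × ℚ)) ∈ Submodule.span ℚ
      ((fun r : T.State × T.State => ((r.1, (1 : ℚ)), (r.2, (1 : ℚ)))) '' T.Rel) :=
      Submodule.subset_span ⟨_, h₀, rfl⟩
    have h3 := Submodule.sub_mem _ h1 (Submodule.smul_mem _ (1 - c) h2)
    have h4 : (((x, c), (x', c)) : (T.State × ℚ) × (T.State × ℚ)) =
        ((x + (1 - c) • x₀, 1), (x' + (1 - c) • x₀', 1)) - (1 - c) • ((x₀, 1), (x₀', 1)) := by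
      ext <;> simp
    rw [← h4] at h3
    exact h3

theorem exists_succ_of_mem_omegaDomain {x : T.State} (hx : x ∈ T.omegaDomain) :
    ∃ x' ∈ T.omegaDomain, (x, x') ∈ T.Rel := by
  obtain ⟨y, rfl, hy⟩ := hx
  exact ⟨y 1, ⟨fun k => y (k + 1), rfl, fun k => hy (k + 1)⟩, hy 0⟩

theorem IsLinear.add_mem (hL : T.IsLinear) {x x' y y' : T.State} (h : (x, x') ∈ T.Rel)
    (h' : (y, y') ∈ T.Rel) : (x + y, x' + y') ∈ T.Rel := by
  obtain ⟨L, hL⟩ := hL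
  rw [← hL] at h h' ⊢
  exact L.add_mem h h'

theorem IsLinear.smul_mem (hL : T.IsLinear) (c : ℚ) {x x' : T.State} (h : (x, x') ∈ T.Rel) :
    (c • x, c • x') ∈ T.Rel := by
  obtain ⟨L, hL⟩ := hL
  rw [← hL] at h ⊢
  exact L.smul_mem c h

theorem IsLinear.zero_mem (hL : T.IsLinear) : ((0 : T.State), (0 : T.State)) ∈ T.Rel := by
  obtain ⟨L, hL⟩ := hL
  rw [← hL]
  exact L.zero_mem

/-- The `ω`-domain of a linear transition system, as a linear subspace. -/
def omegaSubspace (hL : T.IsLinear) : Submodule ℚ T.State where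
  carrier := T.omegaDomain
  add_mem' := by
    rintro _ _ ⟨y, rfl, hy⟩ ⟨z, rfl, hz⟩
    exact ⟨fun k => y k + z k, rfl, fun k => hL.add_mem (hy k) (hz k)⟩
  zero_mem' := ⟨fun _ => 0, rfl, fun _ => hL.zero_mem⟩
  smul_mem' := by
    rintro c _ ⟨y, rfl, hy⟩
    exact ⟨fun k => c • y k, rfl, fun k => hL.smul_mem c (hy k)⟩

/-- The linear map `T|_ω` on the `ω`-domain of a deterministic linear transition system, which
sends every state to its successor. -/
noncomputable def omegaMap (hL : T.IsLinear) (hD : T.IsDeterministic) :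
    omegaSubspace hL →ₗ[ℚ] omegaSubspace hL where
  toFun x := ⟨(exists_succ_of_mem_omegaDomain x.2).choose,
    (exists_succ_of_mem_omegaDomain x.2).choose_spec.1⟩
  map_add' x y := Subtype.ext (hD _ _ _
    (exists_succ_of_mem_omegaDomain (x + y).2).choose_spec.2
    (hL.add_mem (exists_succ_of_mem_omegaDomain x.2).choose_spec.2
      (exists_succ_of_mem_omegaDomain y.2).choose_spec.2))
  map_smul' c x := Subtype.ext (hD _ _ _
    (exists_succ_of_mem_omegaDomain (c • x).2).choose_spec.2
    (hL.smul_mem c (exists_succ_of_mem_omegaDomain x.2).choose_spec.2))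

variable (T) in
/-- Deterministic linear transition systems with rational spectrum: all complex roots of the
characteristic polynomial of `T|_ω` are rational. -/
def IsQDLTS : Prop :=
  ∃ (hL : T.IsLinear) (hD : T.IsDeterministic),
    ∀ z : ℂ, Polynomial.aeval z (omegaMap hL hD).charpoly = 0 → ∃ c : ℚ, (c : ℂ) = z

variable (T) in
/-- Deterministic affine transition systems whose homogenization has rational spectrum. -/
def IsQDATS : Prop := T.IsAffine ∧ T.IsDeterministic ∧ T.homog.IsQDLTS

variable (T) in
theorem homog_isLinear : T.homog.IsLinear := ⟨_, rfl⟩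

theorem IsQDATS.homog_isDeterministic (h : T.IsQDATS) : T.homog.IsDeterministic :=
  h.2.2.choose_spec.choose

/-- `ℤ(T)`: the span of the generalized eigenvectors of `T|_ω` for integer eigenvalues. -/
def intSubspace (hL : T.IsLinear) (hD : T.IsDeterministic) : Submodule ℚ (omegaSubspace hL) :=
  Submodule.span ℚ {x | ∃ r : ℕ, 0 < r ∧ ∃ l : ℤ,
    ((omegaMap hL hD - (l : ℚ) • (1 : Module.End ℚ (omegaSubspace hL))) ^ r :
      Module.End ℚ (omegaSubspace hL)) x = 0}

theorem omegaMap_mem_intSubspace (hL : T.IsLinear) (hD : T.IsDeterministic) :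
    ∀ x ∈ intSubspace hL hD, omegaMap hL hD x ∈ intSubspace hL hD := by
  intro x hx
  have hle : intSubspace hL hD ≤ (intSubspace hL hD).comap (omegaMap hL hD) := by
    refine Submodule.span_le.2 ?_
    rintro y ⟨r, hr, l, hy⟩
    refine Submodule.subset_span ⟨r, hr, l, ?_⟩
    have hc : Commute (omegaMap hL hD)
        ((omegaMap hL hD - (l : ℚ) • (1 : Module.End ℚ (omegaSubspace hL))) ^ r :
          Module.End ℚ (omegaSubspace hL)) :=
      ((Commute.refl _).sub_right ((Commute.one_right _).smul_right _)).pow_right r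
    have h := LinearMap.congr_fun hc.eq y
    simp only [Module.End.mul_apply] at h
    rw [← h, hy, map_zero]
  exact hle hx

/-- `T_ℤ`: the restriction of `T|_ω` to `ℤ(T)`. -/
noncomputable def intMap (hL : T.IsLinear) (hD : T.IsDeterministic) :
    intSubspace hL hD →ₗ[ℚ] intSubspace hL hD :=
  (omegaMap hL hD).restrict (omegaMap_mem_intSubspace hL hD)

end TransitionSystem

/-! ## Transition formulas and mortal preconditions -/

/-- Transition formulas: the variables `Sum.inl x` are the variables `x ∈ X`, and `Sum.inr x` are
their primed copies. -/
abbrev TransitionFormula (X : Type) : Type 1 := LIA.Formula (X ⊕ X)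

/-- The transition system of a transition formula: the states are the maps `X → ℚ`, and the
transitions connect integer-valued states. -/
def TransitionFormula.toTransitionSystem {X : Type} [Fintype X] (F : TransitionFormula X) :
    TransitionSystem where
  State := X → ℚ
  Rel := {r | ∃ v v' : X → ℤ, r = ((fun x => (v x : ℚ)), (fun x => (v' x : ℚ))) ∧
    F.Sat (Sum.elim v v')}

open TransitionSystem in
/-- A run of the procedure for computing a mortal precondition of `F`. The procedure is
nondeterministic; the fields are its choices and intermediate results. -/
structure MortalPreconditionRun {X : Type} [Fintype X] (F : TransitionFormula X) where
  /-- A reflection `⟨V, s⟩` of `F` in the class of rational-spectrum `DATS`. -/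
  V : TransitionSystem
  s : (X → ℚ) →ₗ[ℚ] V.State
  isReflection : F.toTransitionSystem.IsReflection V TransitionSystem.IsQDATS s
  /-- Coordinates on the state space of the homogenization `T` of `V`. -/
  m : ℕ
  stateBasis : Module.Basis (Fin m) ℚ V.homog.State
  /-- The affine simulation `t(x) = (s(x), 1)` from `F` to `T`, in integer coordinates. -/
  tMat : Matrix (Fin m) X ℤ
  tVec : Fin m → ℤ
  t_eq : ∀ (x : X → ℚ) (i : Fin m),
    stateBasis.repr (s x, (1 : ℚ)) i = ∑ j, (tMat i j : ℚ) * x j + (tVec i : ℚ)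
  /-- Coordinates on `ℤ(T)`. -/
  q : ℕ
  intBasis : Module.Basis (Fin q) ℚ (intSubspace V.homog_isLinear isReflection.1.homog_isDeterministic)
  /-- A linear projection `p` of the state space of `T` onto `ℤ(T)`, in integer coordinates. -/
  pMat : Matrix (Fin q) (Fin m) ℤ
  p_eq : ∀ (y : intSubspace V.homog_isLinear isReflection.1.homog_isDeterministic) (i : Fin q),
    ∑ j, (pMat i j : ℚ) * stateBasis.repr (y : omegaSubspace V.homog_isLinear).1 j =
      intBasis.repr y i
  /-- A matrix `C` with `C y = 0` if and only if `y ∈ ℤ(T)`. -/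
  r : ℕ
  C : Matrix (Fin r) (Fin m) ℤ
  C_eq : ∀ y : V.homog.State,
    (∀ i, ∑ j, (C i j : ℚ) * stateBasis.repr y j = 0) ↔
      ∃ y' : intSubspace V.homog_isLinear isReflection.1.homog_isDeterministic,
        (y' : omegaSubspace V.homog_isLinear).1 = y
  /-- A formula `G(w)` that expresses `∃ x, x'. F(x, x') ∧ w = p(t(x)) ∧ C t(x) = 0`. -/
  G : LIA.Formula (Fin q)
  G_eq : ∀ w : Fin q → ℚ, G.Holds w ↔
    ∃ x x' : X → ℤ, F.Sat (Sum.elim x x') ∧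
      (∀ i, w i = ((pMat *ᵥ (tMat *ᵥ x + tVec)) i : ℤ)) ∧ C *ᵥ (tMat *ᵥ x + tVec) = 0
  /-- The characteristic sequence `(H₀, …, H_P)^ω` of `G` with respect to the matrix of `T_ℤ`. -/
  H : ℕ → LIA.Formula (Fin q)
  isCharSeq : LIA.IsCharSeq G
    (LinearMap.toMatrix intBasis intBasis
      (intMap V.homog_isLinear isReflection.1.homog_isDeterministic)) H
  P : ℕ
  hasPeriod : LIA.HasPeriod H P

namespace MortalPreconditionRun

variable {X : Type} [Fintype X] {F : TransitionFormula X} (R : MortalPreconditionRun F)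

/-- The coordinates of `t(x)`, as terms over `X`. -/
noncomputable def tTerm (i : Fin R.m) : LIA.Term X :=
  (LIA.Term.sum ((Finset.univ : Finset X).toList.map
    (fun j => LIA.Term.smul (R.tMat i j) (LIA.Term.var j)))).add (LIA.Term.const (R.tVec i))

/-- The coordinates of `p(t(x))`, as terms over `X`. -/
noncomputable def ptTerm (i : Fin R.q) : LIA.Term X :=
  LIA.Term.sum (List.ofFn (fun j => LIA.Term.smul (R.pMat i j) (R.tTerm j)))

/-- The coordinates of `C t(x)`, as terms over `X`. -/
noncomputable def ctTerm (i : Fin R.r) : LIA.Term X :=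
  LIA.Term.sum (List.ofFn (fun j => LIA.Term.smul (R.C i j) (R.tTerm j)))

/-- The formula `¬ ((⋀ᵢ Hᵢ(p(t(x)))) ∧ C t(x) = 0)` returned by the procedure. -/
noncomputable def output : LIA.Formula X :=
  LIA.Formula.not (LIA.Formula.and
    (LIA.Formula.conj (List.ofFn (fun i : Fin (R.P + 1) => (R.H i).subst R.ptTerm)))
    (LIA.Formula.conj (List.ofFn (fun i => LIA.Formula.eqZero (R.ctTerm i)))))

end MortalPreconditionRun

/-- `M` is a mortal precondition `mp(F)`, as computed by some run of the procedure. -/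
def IsMortalPrecondition {X : Type} [Fintype X] (F : TransitionFormula X) (M : LIA.Formula X) :
    Prop :=
  ∃ R : MortalPreconditionRun F, R.output = M

/-! The formula `mp(F)` depends on many choices, but its set of integer models does not. Write t(x)
= (s(x), 1). An integer vector x falsifies `mp(F)` exactly when t(x) lies in ℤ(T) and, from some
step on, every state on its orbit under T|_ω has the form t(x₁) for an integer x₁ with an
F-successor (`sat_output_iff`). Indeed, at integral vectors a characteristic sequence eventually
agrees with the truth of G along the orbit. Since it is periodic, all its entries hold if and only
if G eventually holds (`IsCharSeq.forall_holds_iff`).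

This orbit condition is monotone (`EventuallyInDomain.mono`). If F₁ ⊨ F₂, then s₂ is also a
simulation of F₁, so it factors as u ∘ s₁ by the universal property of the first reflection. The
homogenization of u sends t₁(x) to t₂(x), commutes with the ω-maps by determinism, and therefore
sends generalized eigenvectors to generalized eigenvectors for the same integer eigenvalue. The
condition for F₁ thus implies the one for F₂, and the negations reverse the implication.

Existence has three ingredients. A reflection is the affine hull of F in a quotient of the state
space by a minimal admissible subspace; admissible subspaces are closed under intersection
(`exists_isReflection`). Cooper's method makes G quantifier-free over ℤ, and divisibility
constraints extend it correctly to rational points (`exists_isCharSeq`). On ℤ(T) the powers of the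
map are exponential-polynomials with integer bases, by the binomial theorem
(`gen_eigenvector_mem_evExp`). -/

open Filter

namespace LIA

/-! ### Evaluation of terms and formulas: casts and substitution -/

namespace Term

theorem eval_cast {X : Type} (t : Term X) (v : X → ℤ) :
    t.eval (fun x => (v x : ℚ)) = ((t.eval v : ℤ) : ℚ) := by
  induction t with
  | var x => rfl
  | const n => simp [eval]
  | smul n t ih => simp [eval, ih]
  | add t₁ t₂ h₁ h₂ => simp [eval, h₁, h₂]

theorem eval_subst {X Y R : Type} [Ring R] (t : Term X) (σ : X → Term Y) (v : Y → R) :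
    (t.subst σ).eval v = t.eval (fun x => (σ x).eval v) := by
  induction t with
  | var x => rfl
  | const n => simp [eval, subst]
  | smul n t ih => simp [eval, subst, ih]
  | add t₁ t₂ h₁ h₂ => simp [eval, subst, h₁, h₂]

theorem eval_sum {X R : Type} [Ring R] (l : List (Term X)) (v : X → R) :
    (sum l).eval v = (l.map (fun t => t.eval v)).sum := by
  induction l with
  | nil => simp [sum, eval]
  | cons t l ih => simp [sum, eval, ih]

/-- The coefficient of the variable `none`. -/
def coeffNone {X : Type} : Term (Option X) → ℤ
  | var o => o.elim 1 (fun _ => 0)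
  | const _ => 0
  | smul n t => n * coeffNone t
  | add t₁ t₂ => coeffNone t₁ + coeffNone t₂

/-- The part of a term that does not contain the variable `none`. -/
def rest {X : Type} : Term (Option X) → Term X
  | var o => o.elim (const 0) var
  | const n => const n
  | smul n t => smul n (rest t)
  | add t₁ t₂ => add (rest t₁) (rest t₂)

theorem eval_elim {X : Type} (t : Term (Option X)) (z : ℤ) (v : X → ℤ) :
    t.eval (fun o => o.elim z v) = t.coeffNone * z + t.rest.eval v := by
  induction t with
  | var o => cases o <;> simp [eval, coeffNone, rest]
  | const n => simp [eval, coeffNone, rest]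
  | smul n t ih => simp only [eval, coeffNone, rest, ih, Int.cast_id]; ring
  | add t₁ t₂ h₁ h₂ => simp only [eval, coeffNone, rest, h₁, h₂]; ring

end Term

namespace Formula

/-- Quantifiers range over ℤ in both readings, so the induction passes through them. -/
theorem holds_cast {X : Type} (φ : Formula X) (v : X → ℤ) :
    φ.Holds (fun x => (v x : ℚ)) ↔ φ.Holds v := by
  induction φ with
  | le t₁ t₂ => simp [Holds, Term.eval_cast]
  | dvd n t =>
    simp only [Holds, Term.eval_cast]
    exact exists_congr fun z => by norm_cast
  | and φ ψ h₁ h₂ => simp [Holds, h₁, h₂]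
  | or φ ψ h₁ h₂ => simp [Holds, h₁, h₂]
  | not φ h => simp [Holds, h]
  | ex φ h =>
    simp only [Holds]
    refine exists_congr fun z => ?_
    rw [← h]
    exact iff_of_eq (congrArg _ (funext fun o => by cases o <;> simp))
  | all φ h =>
    simp only [Holds]
    refine forall_congr' fun z => ?_
    rw [← h]
    exact iff_of_eq (congrArg _ (funext fun o => by cases o <;> simp))

theorem holds_subst {X : Type} (φ : Formula X) :
    ∀ {Y : Type} (σ : X → Term Y) (v : Y → ℤ),
    (φ.subst σ).Holds v ↔ φ.Holds (fun x => (σ x).eval v) := by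
  induction φ with
  | le t₁ t₂ => intros; simp [Holds, subst, Term.eval_subst]
  | dvd n t => intros; simp [Holds, subst, Term.eval_subst]
  | and φ ψ h₁ h₂ => intros; simp [Holds, subst, h₁, h₂]
  | or φ ψ h₁ h₂ => intros; simp [Holds, subst, h₁, h₂]
  | not φ h => intros; simp [Holds, subst, h]
  | ex φ h =>
    intro Y σ v
    simp only [Holds, subst]
    refine exists_congr fun z => ?_
    rw [h]
    refine iff_of_eq (congrArg _ (funext fun o => ?_))
    cases o <;> simp [Term.eval, Term.eval_subst]
  | all φ h =>
    intro Y σ v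
    simp only [Holds, subst]
    refine forall_congr' fun z => ?_
    rw [h]
    refine iff_of_eq (congrArg _ (funext fun o => ?_))
    cases o <;> simp [Term.eval, Term.eval_subst]

theorem holds_verum {X R : Type} [Ring R] [Preorder R] (v : X → R) :
    (verum : Formula X).Holds v := le_refl _

theorem holds_eqZero {X R : Type} [Ring R] [PartialOrder R] (t : Term X) (v : X → R) :
    (eqZero t).Holds v ↔ t.eval v = 0 := by
  simp [eqZero, Holds, Term.eval, le_antisymm_iff]

theorem holds_conj {X R : Type} [Ring R] [Preorder R] (l : List (Formula X)) (v : X → R) :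
    (conj l).Holds v ↔ ∀ φ ∈ l, φ.Holds v := by
  induction l with
  | nil => simpa [conj] using holds_verum v
  | cons φ l ih => simp [conj, Holds, ih]

end Formula

/-! ## Quantifier elimination over the integers -/

/-- The sets of integer valuations that are defined by quantifier-free formulas. -/
inductive QF {X : Type} : ((X → ℤ) → Prop) → Prop
  | le (t : Term X) : QF (fun v => t.eval v ≤ 0)
  | dvd (n : ℤ) (hn : n ≠ 0) (t : Term X) : QF (fun v => n ∣ t.eval v)
  | and {P P' : (X → ℤ) → Prop} : QF P → QF P' → QF (fun v => P v ∧ P' v)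
  | or {P P' : (X → ℤ) → Prop} : QF P → QF P' → QF (fun v => P v ∨ P' v)
  | not {P : (X → ℤ) → Prop} : QF P → QF (fun v => ¬ P v)

namespace QF

variable {X : Type}

theorem congr {P P' : (X → ℤ) → Prop} (h : QF P) (e : ∀ v, P v ↔ P' v) : QF P' := by
  rwa [show P' = P from funext fun v => propext (e v).symm]

theorem of_true : QF (fun _ : X → ℤ => True) :=
  (QF.le (Term.const 0)).congr (by simp [Term.eval])

theorem of_false : QF (fun _ : X → ℤ => False) :=
  (QF.le (Term.const 1)).congr (by simp [Term.eval])

theorem of_prop (p : Prop) : QF (fun _ : X → ℤ => p) := by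
  by_cases h : p
  · exact of_true.congr (by simp [h])
  · exact of_false.congr (by simp [h])

theorem eqZero (t : Term X) : QF (fun v => t.eval v = 0) :=
  ((QF.le t).and (QF.le (t.smul (-1)))).congr fun v => by
    simp [Term.eval, le_antisymm_iff]

theorem finset_ex {ι : Type*} (s : Finset ι) {P : ι → (X → ℤ) → Prop} (h : ∀ i, QF (P i)) :
    QF (fun v => ∃ i ∈ s, P i v) := by
  classical
  induction s using Finset.induction_on with
  | empty => exact of_false.congr (by simp)
  | insert a s _ ih => exact ((h a).or ih).congr (by simp)

theorem list_ex {ι : Type*} (l : List ι) {P : ι → (X → ℤ) → Prop} (h : ∀ i ∈ l, QF (P i)) :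
    QF (fun v => ∃ i ∈ l, P i v) := by
  induction l with
  | nil => exact of_false.congr (by simp)
  | cons a l ih =>
    exact ((h a (by simp)).or (ih fun i hi => h i (by simp [hi]))).congr (by simp)

theorem finite_all {ι : Type*} [Fintype ι] {P : ι → (X → ℤ) → Prop} (h : ∀ i, QF (P i)) :
    QF (fun v => ∀ i, P i v) :=
  (finset_ex Finset.univ (fun i => (h i).not)).not.congr fun v => by simp

theorem subst {Y : Type} (σ : X → Term Y) {P : (X → ℤ) → Prop} (h : QF P) :
    QF (fun v : Y → ℤ => P (fun x => (σ x).eval v)) := by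
  induction h with
  | le t => exact (QF.le (t.subst σ)).congr fun v => by rw [Term.eval_subst]
  | dvd n hn t => exact (QF.dvd n hn (t.subst σ)).congr fun v => by rw [Term.eval_subst]
  | and _ _ h h' => exact h.and h'
  | or _ _ h h' => exact h.or h'
  | not _ h => exact h.not

/-- Substitution of `u / c` for the variable `none`. -/
theorem subst_div {P : (Option X → ℤ) → Prop} (h : QF P) {c : ℤ} (hc : 0 < c) (u : Term X) :
    ∃ P' : (X → ℤ) → Prop, QF P' ∧
      ∀ v z, c * z = u.eval v → (P' v ↔ P (fun o => o.elim z v)) := by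
  -- Division is avoided by scaling: the value of the term at `u / c`, multiplied by `c`, is again a
  -- term. As `c > 0`, signs are kept, and divisibility by `n` becomes divisibility by `c * n`.
  have key : ∀ (t : Term (Option X)) v z, c * z = u.eval v →
      ((u.smul t.coeffNone).add (t.rest.smul c)).eval v =
        c * t.eval (fun o => o.elim z v) := by
    intro t v z h
    rw [Term.eval_elim]
    simp only [Term.eval, ← h, Int.cast_id]
    ring
  induction h with
  | le t =>
    refine ⟨_, QF.le ((u.smul t.coeffNone).add (t.rest.smul c)), fun v z h => ?_⟩
    rw [key t v z h]
    exact ⟨fun h => by nlinarith, fun h => by nlinarith⟩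
  | dvd n hn t =>
    refine ⟨_, QF.dvd (c * n) (mul_ne_zero hc.ne' hn) ((u.smul t.coeffNone).add (t.rest.smul c)),
      fun v z h => ?_⟩
    rw [key t v z h]
    exact mul_dvd_mul_iff_left hc.ne'
  | and _ _ h h' =>
    obtain ⟨A, hA, h⟩ := h
    obtain ⟨B, hB, h'⟩ := h'
    exact ⟨_, hA.and hB, fun v z e => and_congr (h v z e) (h' v z e)⟩
  | or _ _ h h' =>
    obtain ⟨A, hA, h⟩ := h
    obtain ⟨B, hB, h'⟩ := h'
    exact ⟨_, hA.or hB, fun v z e => or_congr (h v z e) (h' v z e)⟩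
  | not _ h =>
    obtain ⟨A, hA, h⟩ := h
    exact ⟨_, hA.not, fun v z e => not_congr (h v z e)⟩

/-- A truth value changes between `z` and `z - D` only close to a zero of one of finitely many
terms. -/
theorem exists_boundary {P : (Option X → ℤ) → Prop} (h : QF P) :
    ∃ (D₀ : ℤ) (l : List (ℤ × Term X)), 0 < D₀ ∧ (∀ b ∈ l, 0 < b.1) ∧
      ∀ D, 0 < D → D₀ ∣ D → ∀ v z,
        (∀ b ∈ l, b.1 * D < |b.1 * z - b.2.eval v|) →
          (P (fun o => o.elim z v) ↔ P (fun o => o.elim (z - D) v)) := by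
  induction h with
  | le t =>
    -- The shift by `D` changes the term by `|t.coeffNone| * D`, so its sign survives if its
    -- absolute value is larger. The pair in the list describes the zero of the term, normalized to
    -- a positive coefficient.
    rcases lt_trichotomy t.coeffNone 0 with h | h | h
    · refine ⟨1, [(-t.coeffNone, t.rest)], one_pos, by simpa using h, fun D hD _ v z hb => ?_⟩
      simp only [List.mem_singleton, forall_eq] at hb
      beta_reduce
      rw [Term.eval_elim, Term.eval_elim]
      rcases lt_abs.1 hb with hb | hb
      · exact ⟨fun _ => by nlinarith, fun _ => by nlinarith⟩
      · exact ⟨fun _ => by nlinarith, fun _ => by nlinarith⟩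
    · refine ⟨1, [], one_pos, by simp, fun D hD _ v z hb => ?_⟩
      simp [Term.eval_elim, h]
    · refine ⟨1, [(t.coeffNone, t.rest.smul (-1))], one_pos, by simpa using h,
        fun D hD _ v z hb => ?_⟩
      simp only [List.mem_singleton, forall_eq, Term.eval, Int.cast_id] at hb
      beta_reduce
      rw [Term.eval_elim, Term.eval_elim]
      rcases lt_abs.1 hb with hb | hb
      · exact ⟨fun _ => by nlinarith, fun _ => by nlinarith⟩
      · exact ⟨fun _ => by nlinarith, fun _ => by nlinarith⟩
  | dvd n hn t =>
    refine ⟨|n|, [], abs_pos.2 hn, by simp, fun D hD hnD v z _ => ?_⟩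
    beta_reduce
    rw [Term.eval_elim, Term.eval_elim,
      show t.coeffNone * z + t.rest.eval v =
        (t.coeffNone * (z - D) + t.rest.eval v) + t.coeffNone * D by ring]
    exact dvd_add_left (((abs_dvd n D).1 hnD).mul_left _)
  | and _ _ h h' =>
    obtain ⟨D₁, l₁, h₁, hl₁, h⟩ := h
    obtain ⟨D₂, l₂, h₂, hl₂, h'⟩ := h'
    refine ⟨D₁ * D₂, l₁ ++ l₂, mul_pos h₁ h₂, by
      simpa [or_imp, forall_and] using ⟨by simpa using hl₁, by simpa using hl₂⟩,
      fun D hD hd v z hb => ?_⟩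
    exact and_congr
      (h D hD ((dvd_mul_right _ _).trans hd) v z fun b hb' => hb b (by simp [hb']))
      (h' D hD ((dvd_mul_left _ _).trans hd) v z fun b hb' => hb b (by simp [hb']))
  | or _ _ h h' =>
    obtain ⟨D₁, l₁, h₁, hl₁, h⟩ := h
    obtain ⟨D₂, l₂, h₂, hl₂, h'⟩ := h'
    refine ⟨D₁ * D₂, l₁ ++ l₂, mul_pos h₁ h₂, by
      simpa [or_imp, forall_and] using ⟨by simpa using hl₁, by simpa using hl₂⟩,
      fun D hD hd v z hb => ?_⟩
    exact or_congr
      (h D hD ((dvd_mul_right _ _).trans hd) v z fun b hb' => hb b (by simp [hb']))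
      (h' D hD ((dvd_mul_left _ _).trans hd) v z fun b hb' => hb b (by simp [hb']))
  | not _ h =>
    obtain ⟨D₁, l₁, h₁, hl₁, h⟩ := h
    exact ⟨D₁, l₁, h₁, hl₁, fun D hD hd v z hb => not_congr (h D hD hd v z hb)⟩

/-- The truth value for all sufficiently small values of the variable `none`. -/
theorem exists_minus_infinity {P : (Option X → ℤ) → Prop} (h : QF P) :
    ∃ (D₀ : ℤ) (I : ℤ → (X → ℤ) → Prop), 0 < D₀ ∧ (∀ j, QF (I j)) ∧
      ∀ v, ∃ Z, ∀ z ≤ Z, ∀ j, D₀ ∣ z - j → (P (fun o => o.elim z v) ↔ I j v) := by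
  induction h with
  | le t =>
    by_cases h : t.coeffNone = 0
    · refine ⟨1, fun _ v => t.rest.eval v ≤ 0, one_pos, fun _ => QF.le _, fun v => ⟨0, ?_⟩⟩
      intro z _ j _
      beta_reduce
      rw [Term.eval_elim, h]
      simp
    -- Below `-|t.rest.eval v| - 1` the linear part outweighs the rest, because its coefficient is a
    -- nonzero integer.
    · refine ⟨1, fun _ _ => 0 < t.coeffNone, one_pos, fun _ => of_prop _,
        fun v => ⟨-|t.rest.eval v| - 1, ?_⟩⟩
      intro z hz j _
      beta_reduce
      rw [Term.eval_elim]
      have h1 := le_abs_self (t.rest.eval v)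
      have h2 := neg_abs_le (t.rest.eval v)
      rcases lt_or_gt_of_ne h with h | h
      · exact iff_of_false (by nlinarith) h.not_gt
      · exact iff_of_true (by nlinarith) h
  | dvd n hn t =>
    refine ⟨|n|, fun j v => n ∣ ((Term.const (t.coeffNone * j)).add t.rest).eval v,
      abs_pos.2 hn, fun j => QF.dvd n hn _, fun v => ⟨0, fun z _ j hj => ?_⟩⟩
    beta_reduce
    rw [Term.eval_elim, show t.coeffNone * z + t.rest.eval v =
        ((Term.const (t.coeffNone * j)).add t.rest).eval v + t.coeffNone * (z - j) by
          simp [Term.eval]; ring]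
    exact dvd_add_left (((abs_dvd n _).1 hj).mul_left _)
  | and _ _ h h' =>
    obtain ⟨D₁, I₁, h₁, hI₁, h⟩ := h
    obtain ⟨D₂, I₂, h₂, hI₂, h'⟩ := h'
    refine ⟨D₁ * D₂, _, mul_pos h₁ h₂, fun j => (hI₁ j).and (hI₂ j), fun v => ?_⟩
    obtain ⟨Z₁, hZ₁⟩ := h v
    obtain ⟨Z₂, hZ₂⟩ := h' v
    exact ⟨min Z₁ Z₂, fun z hz j hj => and_congr
      (hZ₁ z (hz.trans (min_le_left _ _)) j ((dvd_mul_right _ _).trans hj))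
      (hZ₂ z (hz.trans (min_le_right _ _)) j ((dvd_mul_left _ _).trans hj))⟩
  | or _ _ h h' =>
    obtain ⟨D₁, I₁, h₁, hI₁, h⟩ := h
    obtain ⟨D₂, I₂, h₂, hI₂, h'⟩ := h'
    refine ⟨D₁ * D₂, _, mul_pos h₁ h₂, fun j => (hI₁ j).or (hI₂ j), fun v => ?_⟩
    obtain ⟨Z₁, hZ₁⟩ := h v
    obtain ⟨Z₂, hZ₂⟩ := h' v
    exact ⟨min Z₁ Z₂, fun z hz j hj => or_congr
      (hZ₁ z (hz.trans (min_le_left _ _)) j ((dvd_mul_right _ _).trans hj))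
      (hZ₂ z (hz.trans (min_le_right _ _)) j ((dvd_mul_left _ _).trans hj))⟩
  | not _ h =>
    obtain ⟨D₁, I₁, h₁, hI₁, h⟩ := h
    refine ⟨D₁, _, h₁, fun j => (hI₁ j).not, fun v => ?_⟩
    obtain ⟨Z₁, hZ₁⟩ := h v
    exact ⟨Z₁, fun z hz j hj => not_congr (hZ₁ z hz j hj)⟩

/-- Cooper's elimination of an existential quantifier. -/
theorem ex {P : (Option X → ℤ) → Prop} (h : QF P) :
    QF (fun v => ∃ z : ℤ, P (fun o => o.elim z v)) := by
  obtain ⟨D₁, l, hD₁, hl, hb⟩ := h.exists_boundary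
  obtain ⟨D₂, I, hD₂, hI, hm⟩ := h.exists_minus_infinity
  set D := D₁ * D₂ with hD
  have hDpos : 0 < D := mul_pos hD₁ hD₂
  -- Either the formula holds arbitrarily far down in some residue class, or it has a witness `z`
  -- with `b.1 * z` within `b.1 * D` of a boundary value. Both alternatives range over finite sets.
  have h1 : QF (fun v => ∃ j ∈ Finset.Ico 0 D₂, I j v) := finset_ex _ hI
  have h2 : QF (fun v => ∃ b ∈ l, ∃ j ∈ Finset.Icc (-(b.1 * D)) (b.1 * D),
      ∃ z, b.1 * z = b.2.eval v + j ∧ P (fun o => o.elim z v)) := by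
    refine list_ex _ fun b hbl => finset_ex _ fun j => ?_
    obtain ⟨P', hP', e⟩ := h.subst_div (hl b hbl) (b.2.add (Term.const j))
    refine ((QF.dvd b.1 (hl b hbl).ne' (b.2.add (Term.const j))).and hP').congr fun v => ?_
    constructor
    · rintro ⟨⟨z, hz⟩, hv⟩
      exact ⟨z, by simpa [Term.eval] using hz.symm, (e v z hz.symm).1 hv⟩
    · rintro ⟨z, hz, hv⟩
      have hz' : b.1 * z = (b.2.add (Term.const j)).eval v := by simpa [Term.eval] using hz
      exact ⟨⟨z, hz'.symm⟩, (e v z hz').2 hv⟩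
  refine (h1.or h2).congr fun v => ?_
  constructor
  · rintro (⟨j, -, hj⟩ | ⟨b, -, j, -, z, -, hz⟩)
    · obtain ⟨Z, hZ⟩ := hm v
      have hle : j - D₂ * (|j| + |Z|) ≤ Z := by
        have := le_abs_self j
        have := neg_abs_le Z
        have := abs_nonneg j
        have := abs_nonneg Z
        nlinarith
      exact ⟨_, (hZ _ hle j ⟨-(|j| + |Z|), by ring⟩).2 hj⟩
    · exact ⟨z, hz⟩
  · rintro ⟨z, hz⟩
    by_contra hcon
    rw [not_or] at hcon
    obtain ⟨hc1, hc2⟩ := hcon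
    -- With no witness near a boundary, truth is inherited from `z` by `z - D` and so on downwards,
    -- until the first alternative is forced.
    have hall : ∀ n : ℕ, P (fun o => o.elim (z - n * D) v) := by
      intro n
      induction n with
      | zero => simpa using hz
      | succ n ih =>
        have hstep := (hb D hDpos (dvd_mul_right _ _) v (z - n * D) ?_).1 ih
        · rwa [show z - n * D - D = z - ((n + 1 : ℕ) : ℤ) * D by push_cast; ring] at hstep
        · intro b hbl
          by_contra hlt
          obtain ⟨ha, ha'⟩ := abs_le.1 (not_lt.1 hlt)
          exact hc2 ⟨b, hbl, b.1 * (z - n * D) - b.2.eval v, Finset.mem_Icc.2 ⟨ha, ha'⟩,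
            z - n * D, by ring, ih⟩
    obtain ⟨Z, hZ⟩ := hm v
    have hle : z - ((|z| + |Z|).toNat : ℤ) * D ≤ Z := by
      rw [Int.toNat_of_nonneg (by positivity)]
      have := le_abs_self z
      have := neg_abs_le Z
      have := abs_nonneg z
      have := abs_nonneg Z
      nlinarith
    set z' := z - ((|z| + |Z|).toNat : ℤ) * D
    refine hc1 ⟨z' % D₂, Finset.mem_Ico.2 ⟨Int.emod_nonneg _ hD₂.ne', Int.emod_lt_of_pos _ hD₂⟩,
      (hZ z' hle _ (Int.dvd_self_sub_emod)).1 (hall _)⟩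

/-- Every formula of linear integer arithmetic is equivalent over the integers to a
quantifier-free one. -/
theorem of_formula {X : Type} (φ : Formula X) : QF φ.Sat := by
  induction φ with
  | le t₁ t₂ =>
    refine (QF.le (t₁.add (t₂.smul (-1)))).congr fun v => ?_
    simp [Formula.Sat, Formula.Holds, Term.eval]
  | dvd n t =>
    by_cases hn : n = 0
    -- Divisibility by 0 is equality with 0. Nonzero moduli are needed later, as the residues of `λ
    -- ^ k * k ^ d` need not become periodic modulo 0.
    · refine (eqZero t).congr fun v => ?_
      simp [Formula.Sat, Formula.Holds, hn]
    · refine (QF.dvd n hn t).congr fun v => ?_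
      simp [Formula.Sat, Formula.Holds, dvd_def]
  | and φ ψ h₁ h₂ => exact h₁.and h₂
  | or φ ψ h₁ h₂ => exact h₁.or h₂
  | not φ h => exact h.not
  | ex φ h => exact h.ex
  | all φ h =>
    refine h.not.ex.not.congr fun v => ?_
    simp [Formula.Sat, Formula.Holds]

/-- A finite block of quantifiers is eliminated one variable at a time; passing from `Y` to `Option
Y` adds one application of `QF.ex`. -/
theorem ex_finite (Y : Type) [Finite Y] :
    ∀ {X : Type} {P : (X ⊕ Y → ℤ) → Prop}, QF P →
      QF (fun v => ∃ y : Y → ℤ, P (Sum.elim v y)) := by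
  induction Y using Finite.induction_empty_option with
  | of_equiv e ih =>
    intro X P h
    refine (ih (h.subst (fun i => Term.var (Sum.map id e.symm i)))).congr fun v => ?_
    constructor
    · rintro ⟨y, hy⟩
      refine ⟨y ∘ e.symm, ?_⟩
      convert hy using 1
      ext i; cases i <;> simp [Term.eval]
    · rintro ⟨y, hy⟩
      refine ⟨y ∘ e, ?_⟩
      convert hy using 1
      ext i; cases i <;> simp [Term.eval]
  | h_empty =>
    intro X P h
    refine (h.subst (Sum.elim Term.var PEmpty.elim)).congr fun v => ?_
    constructor
    · intro hv
      refine ⟨PEmpty.elim, ?_⟩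
      convert hv using 1
      ext i; rcases i with i | i
      · simp [Term.eval]
      · exact i.elim
    · rintro ⟨y, hy⟩
      convert hy using 1
      ext i; rcases i with i | i
      · simp [Term.eval]
      · exact i.elim
  | h_option ih =>
    intro X P h
    have h' := (ih (h.subst (Y := Option X ⊕ _) (Sum.elim (fun x => Term.var (Sum.inl (some x)))
      (fun o => o.elim (Term.var (Sum.inl none)) (fun y => Term.var (Sum.inr y)))))).ex
    refine h'.congr fun v => ?_
    constructor
    · rintro ⟨z, y, hy⟩
      refine ⟨fun o => o.elim z y, ?_⟩
      convert hy using 1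
      ext i; rcases i with i | (_ | i) <;> simp [Term.eval]
    · rintro ⟨y, hy⟩
      refine ⟨y none, fun i => y (some i), ?_⟩
      convert hy using 1
      ext i; rcases i with i | (_ | i) <;> simp [Term.eval]

end QF

end LIA

namespace LIA

/-! ## Exponential-polynomial sequences -/

/-- The sequence `λ ^ k * k ^ d`. -/
def expMono (s : ℤ × ℕ) (k : ℕ) : ℚ := (s.1 : ℚ) ^ k * (k : ℚ) ^ s.2

/-- The sequences that eventually are linear combinations of sequences `λ ^ k * k ^ d` with
bases `λ` from `Λ`. -/
def evExp (Λ : Set ℤ) : Submodule ℚ (ℕ → ℚ) where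
  carrier := {f | ∃ g ∈ Submodule.span ℚ (expMono '' {s | s.1 ∈ Λ}), f =ᶠ[atTop] g}
  add_mem' := by
    rintro _ _ ⟨g, hg, h⟩ ⟨g', hg', h'⟩
    exact ⟨g + g', add_mem hg hg', h.add h'⟩
  zero_mem' := ⟨0, zero_mem _, EventuallyEq.rfl⟩
  smul_mem' := by
    rintro c _ ⟨g, hg, h⟩
    exact ⟨c • g, Submodule.smul_mem _ c hg, h.const_smul c⟩

variable {Λ : Set ℤ}

theorem evExp_congr {f g : ℕ → ℚ} (hg : g ∈ evExp Λ) (h : f =ᶠ[atTop] g) : f ∈ evExp Λ := by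
  obtain ⟨g', hg', h'⟩ := hg
  exact ⟨g', hg', h.trans h'⟩

theorem expMono_mem_evExp {s : ℤ × ℕ} (hs : s.1 ∈ Λ) : expMono s ∈ evExp Λ :=
  ⟨_, Submodule.subset_span ⟨s, hs, rfl⟩, EventuallyEq.rfl⟩

theorem pow_mul_eval_mem_evExp {l : ℤ} (hl : l ∈ Λ) (p : Polynomial ℚ) :
    (fun k : ℕ => (l : ℚ) ^ k * p.eval (k : ℚ)) ∈ evExp Λ := by
  have : (fun k : ℕ => (l : ℚ) ^ k * p.eval (k : ℚ)) =
      ∑ i ∈ Finset.range (p.natDegree + 1), p.coeff i • expMono (l, i) := by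
    ext k
    simp only [Polynomial.eval_eq_sum_range, Finset.mul_sum, Finset.sum_apply, Pi.smul_apply,
      smul_eq_mul, expMono]
    exact Finset.sum_congr rfl fun i _ => by ring
  rw [this]
  exact sum_mem fun i _ => Submodule.smul_mem _ _ (expMono_mem_evExp hl)

theorem const_mem_evExp (h1 : (1 : ℤ) ∈ Λ) (c : ℚ) : (fun _ => c) ∈ evExp Λ := by
  simpa using pow_mul_eval_mem_evExp h1 (Polynomial.C c)

/-- The subsequences `f (2 * k + b)` only need positive bases. -/
theorem comp_two_mul_add_mem_evExp {f : ℕ → ℚ} (hf : f ∈ evExp Λ) (b : ℕ) :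
    (fun k => f (2 * k + b)) ∈ evExp {l | 0 < l} := by
  obtain ⟨g, hg, h⟩ := hf
  have ht : Tendsto (fun k : ℕ => 2 * k + b) atTop atTop :=
    tendsto_atTop_mono (fun k => show k ≤ 2 * k + b by omega) tendsto_id
  refine evExp_congr (g := fun k => g (2 * k + b)) ?_ (ht.eventually h)
  refine Submodule.span_induction (p := fun g _ => (fun k => g (2 * k + b)) ∈ evExp {l | 0 < l})
    ?_ ?_ ?_ ?_ hg
  · rintro _ ⟨⟨l, d⟩, -, rfl⟩
    by_cases hl : l = 0
    · refine evExp_congr (zero_mem _) ?_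
      filter_upwards [eventually_gt_atTop 0] with k hk
      simp only [expMono, hl, Int.cast_zero, Pi.zero_apply]
      rw [zero_pow (by omega), zero_mul]
    -- The new base is `l ^ 2 > 0`; the factor `l ^ b` and the power `(2 * k + b) ^ d` go into the
    -- polynomial.
    · have := pow_mul_eval_mem_evExp (Λ := {l | 0 < l}) (l := l ^ 2) (by
        simpa using (sq_nonneg l).lt_of_ne (by positivity))
        (Polynomial.C ((l : ℚ) ^ b) * (Polynomial.C 2 * Polynomial.X + Polynomial.C (b : ℚ)) ^ d)
      refine evExp_congr this (Eventually.of_forall fun k => ?_)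
      simp [expMono, pow_add, pow_mul]
      ring
  · exact zero_mem _
  · intro g g' _ _ h h'
    exact add_mem h h'
  · intro c g _ h
    exact Submodule.smul_mem _ c h

/-- Write M = l + N with N ^ r x = 0. By the binomial theorem M ^ k x is a sum over i < r of C(k, i)
l ^ (k - i) N ^ i x, and C(k, i) is a polynomial in k. -/
theorem gen_eigenvector_mem_evExp {V : Type*} [AddCommGroup V] [Module ℚ V] (M : Module.End ℚ V)
    (l : ℤ) (r : ℕ) (x : V) (hx : ((M - (l : ℚ) • (1 : Module.End ℚ V)) ^ r) x = 0)
    (ℓ : V →ₗ[ℚ] ℚ) : (fun k => ℓ ((M ^ k) x)) ∈ evExp Set.univ := by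
  set N := M - (l : ℚ) • (1 : Module.End ℚ V) with hN
  have hpow : ∀ k, (M ^ k) x = ∑ i ∈ Finset.range (k + 1),
      ((l : ℚ) ^ (k - i) * (k.choose i : ℚ)) • (N ^ i) x := by
    intro k
    have hM : M = N + (l : ℚ) • (1 : Module.End ℚ V) := by simp [hN]
    have hc : Commute N ((l : ℚ) • (1 : Module.End ℚ V)) := (Commute.one_right _).smul_right _
    rw [hM, hc.add_pow, LinearMap.sum_apply]
    refine Finset.sum_congr rfl fun i _ => ?_
    rw [smul_pow, one_pow, mul_smul_comm, mul_one, ← nsmul_eq_mul', LinearMap.smul_apply,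
      LinearMap.smul_apply, ← Nat.cast_smul_eq_nsmul ℚ, smul_smul, mul_comm]
  have hpow' : ∀ k ≥ r, (M ^ k) x = ∑ i ∈ Finset.range r,
      ((l : ℚ) ^ (k - i) * (k.choose i : ℚ)) • (N ^ i) x := by
    intro k hk
    rw [hpow]
    symm
    refine Finset.sum_subset (Finset.range_mono (by omega)) fun i _ hi => ?_
    have : r ≤ i := by simpa using hi
    obtain ⟨j, rfl⟩ := Nat.exists_eq_add_of_le this
    rw [add_comm r j, pow_add, Module.End.mul_apply, hx, map_zero, smul_zero]
  have hmem : (∑ i ∈ Finset.range r, (ℓ ((N ^ i) x)) • fun k : ℕ =>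
      (l : ℚ) ^ (k - i) * (k.choose i : ℚ)) ∈ evExp Set.univ := by
    refine sum_mem fun i _ => Submodule.smul_mem _ _ ?_
    -- For `l = 0` the summand vanishes once `k > i`; this nilpotent part is why closed forms are
    -- required only for large `k`.
    by_cases hl : l = 0
    · refine evExp_congr (zero_mem _) ?_
      filter_upwards [eventually_gt_atTop i] with k hk
      simp only [hl, Int.cast_zero, Pi.zero_apply]
      rw [zero_pow (by omega), zero_mul]
    · refine evExp_congr (pow_mul_eval_mem_evExp (Set.mem_univ l)
        (Polynomial.C (((l : ℚ) ^ i)⁻¹ * ((i.factorial : ℚ))⁻¹) * descPochhammer ℚ i)) ?_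
      filter_upwards [eventually_ge_atTop i] with k hk
      have hl' : (l : ℚ) ≠ 0 := by exact_mod_cast hl
      rw [pow_sub₀ _ hl' hk, Nat.cast_choose_eq_descPochhammer_div]
      simp only [Polynomial.eval_mul, Polynomial.eval_C]
      ring
  refine evExp_congr hmem ?_
  filter_upwards [eventually_ge_atTop r] with k hk
  rw [hpow' k hk, map_sum, Finset.sum_apply]
  exact Finset.sum_congr rfl fun i _ => by simp [mul_comm]

theorem exists_finsupp_of_mem_evExp {f : ℕ → ℚ} (hf : f ∈ evExp Λ) :
    ∃ c : (ℤ × ℕ) →₀ ℚ, (∀ s ∈ c.support, s.1 ∈ Λ) ∧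
      ∀ᶠ k in atTop, f k = ∑ s ∈ c.support, c s * expMono s k := by
  obtain ⟨g, hg, h⟩ := hf
  rw [Finsupp.mem_span_image_iff_linearCombination] at hg
  obtain ⟨c, hc, rfl⟩ := hg
  refine ⟨c, fun s hs => (Finsupp.mem_supported ℚ c).1 hc hs, ?_⟩
  filter_upwards [h] with k hk
  rw [hk, Finsupp.linearCombination_apply, Finsupp.sum, Finset.sum_apply]
  simp

theorem exists_common_denominator {ι : Type*} (s : Finset ι) (f : ι → ℚ) :
    ∃ N : ℕ, 0 < N ∧ ∃ z : ι → ℤ, ∀ i ∈ s, (N : ℚ) * f i = z i := by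
  refine ⟨∏ i ∈ s, (f i).den, Finset.prod_pos fun i _ => (f i).pos, ?_⟩
  refine ⟨fun i => ((∏ i ∈ s, (f i).den) / (f i).den : ℕ) * (f i).num, fun i hi => ?_⟩
  obtain ⟨c, hc⟩ := Finset.dvd_prod_of_mem (fun i => (f i).den) hi
  simp only [hc, Nat.mul_div_cancel_left _ (f i).pos]
  push_cast
  rw [mul_right_comm, mul_comm ((f i).den : ℚ), Rat.mul_den_eq_num]
  ring

/-! ## Closed forms -/

namespace Term

variable {q : ℕ}

/-- The affine term with the given coefficients. -/
def ofCoeffs (a : Fin q → ℤ) (d : ℤ) : Term (Fin q) :=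
  (sum (List.ofFn fun j => smul (a j) (var j))).add (const d)

theorem eval_ofCoeffs {R : Type} [Ring R] (a : Fin q → ℤ) (d : ℤ) (w : Fin q → R) :
    (ofCoeffs a d).eval w = ∑ j, (a j : R) * w j + d := by
  simp [ofCoeffs, eval, eval_sum, List.map_ofFn, List.sum_ofFn]

theorem exists_coeffs (t : Term (Fin q)) :
    ∃ (c : Fin q → ℤ) (d : ℤ), ∀ w : Fin q → ℚ, t.eval w = ∑ i, (c i : ℚ) * w i + d := by
  induction t with
  | var i => exact ⟨Pi.single i 1, 0, fun w => by simp [eval, Pi.single_apply]⟩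
  | const n => exact ⟨0, n, fun w => by simp [eval]⟩
  | smul n t ih =>
    obtain ⟨c, d, h⟩ := ih
    refine ⟨n • c, n * d, fun w => ?_⟩
    simp [eval, h, mul_add, Finset.mul_sum, mul_assoc]
  | add t₁ t₂ h₁ h₂ =>
    obtain ⟨c₁, d₁, h₁⟩ := h₁
    obtain ⟨c₂, d₂, h₂⟩ := h₂
    refine ⟨c₁ + c₂, d₁ + d₂, fun w => ?_⟩
    simp only [eval, h₁, h₂, Pi.add_apply, Int.cast_add, add_mul, Finset.sum_add_distrib]
    ring

end Term

/-- The order of dominance is the decreasing lexicographic order on pairs (λ, d), and it is strict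
because a finite set has no repetitions. -/
theorem exists_expPoly {q : ℕ} (S : Finset (ℤ × ℕ)) (a : Fin q → ℤ × ℕ → ℤ) (d : ℤ × ℕ → ℤ) :
    ∃ p : ExpPoly (Fin q), (∀ s ∈ p, (s.1, s.2.1) ∈ S) ∧
      p.Pairwise (fun s s' => s'.1 < s.1 ∨ (s.1 = s'.1 ∧ s'.2.1 < s.2.1)) ∧
      ∀ w k, p.eval w k = ∑ s ∈ S, expMono s k * (∑ j, (a j s : ℚ) * w j + d s) := by
  classical
  let S' : Finset (ℤ ×ₗ ℕ) := S.map toLex.toEmbedding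
  let l := S'.sort (· ≥ ·)
  let g : ℤ ×ₗ ℕ → ℤ × ℕ × Term (Fin q) := fun s =>
    ((ofLex s).1, (ofLex s).2, Term.ofCoeffs (fun j => a j (ofLex s)) (d (ofLex s)))
  refine ⟨l.map g, ?_, ?_, ?_⟩
  · intro s hs
    obtain ⟨u, hu, rfl⟩ := List.mem_map.1 hs
    have hu' : u ∈ S' := (Finset.mem_sort _).1 hu
    obtain ⟨v, hv, rfl⟩ := Finset.mem_map.1 hu'
    exact hv
  · rw [List.pairwise_map]
    refine (Finset.sortedGT_sort S').pairwise.imp fun {u v} h => ?_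
    rcases Prod.Lex.lt_iff.1 (show v < u from h) with h | h
    · exact Or.inl h
    · exact Or.inr ⟨h.1.symm, h.2⟩
  · intro w k
    rw [ExpPoly.eval, List.map_map]
    have : (l.map ((fun s : ℤ × ℕ × Term (Fin q) =>
        (s.1 : ℚ) ^ k * (k : ℚ) ^ s.2.1 * s.2.2.eval w) ∘ g)).sum =
        ∑ s ∈ S', expMono (ofLex s) k * (∑ j, (a j (ofLex s) : ℚ) * w j + d (ofLex s)) := by
      rw [← Finset.sum_map_toList, ← (Finset.sort_perm_toList S' (· ≥ ·)).map _ |>.sum_eq]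
      congr 1
      refine List.map_congr_left fun s _ => ?_
      simp [g, Term.eval_ofCoeffs, expMono]
    rw [this, Finset.sum_map]
    rfl

/-- As a function of x, t(B k x) is affine, and its coefficients are combinations of entries of B k.
Expanding them over one common set of pairs (λ, d) and clearing denominators by Q yields integer
affine terms. -/
theorem exists_closedForm {q : ℕ} (B : ℕ → Matrix (Fin q) (Fin q) ℚ) (h1 : (1 : ℤ) ∈ Λ)
    (hB : ∀ i j, (fun k => B k i j) ∈ evExp Λ) (t : Term (Fin q)) :
    ∃ (Q : ℕ) (p : ExpPoly (Fin q)), ExpPoly.IsClosedForm B t Q p ∧ (∀ s ∈ p, s.1 ∈ Λ) ∧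
      p.Pairwise (fun s s' => s'.1 < s.1 ∨ (s.1 = s'.1 ∧ s'.2.1 < s.2.1)) := by
  classical
  obtain ⟨e, e₀, ht⟩ := t.exists_coeffs
  -- The index `none` stands for the constant coefficient; it is the reason for `1 ∈ Λ`.
  have hf : ∀ o : Option (Fin q), (fun k => o.elim (e₀ : ℚ) (fun j => ∑ i, (e i : ℚ) * B k i j)) ∈
      evExp Λ := by
    rintro (_ | j)
    · exact const_mem_evExp h1 _
    · have : (fun k => ∑ i, (e i : ℚ) * B k i j) = ∑ i, (e i : ℚ) • fun k => B k i j := by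
        ext k; simp
      simp only [Option.elim_some, this]
      exact sum_mem fun i _ => Submodule.smul_mem _ _ (hB i j)
  choose c hcΛ hc using fun o => exists_finsupp_of_mem_evExp (hf o)
  let S : Finset (ℤ × ℕ) := Finset.univ.biUnion fun o => (c o).support
  obtain ⟨Q, hQ, z, hz⟩ := exists_common_denominator
    ((Finset.univ : Finset (Option (Fin q))) ×ˢ S) (fun x => c x.1 x.2)
  obtain ⟨p, hpS, hp, hpe⟩ := exists_expPoly S (fun j s => z (some j, s)) (fun s => z (none, s))
  refine ⟨Q, p, ⟨hQ, ?_⟩, ?_, hp⟩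
  · obtain ⟨K, hK⟩ := eventually_atTop.1 (eventually_all.2 hc)
    refine ⟨K, fun k hk x => ?_⟩
    have hval : ∀ o : Option (Fin q), (Q : ℚ) * o.elim (e₀ : ℚ) (fun j => ∑ i, (e i : ℚ) * B k i j) =
        ∑ s ∈ S, (z (o, s) : ℚ) * expMono s k := by
      intro o
      rw [hK k hk o, Finset.mul_sum]
      refine (Finset.sum_subset (Finset.subset_biUnion_of_mem (fun o => (c o).support)
        (Finset.mem_univ o)) fun s _ hs => ?_).trans (Finset.sum_congr rfl fun s hs => ?_)
      · rw [Finsupp.notMem_support_iff.1 hs]; ring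
      · rw [← mul_assoc, hz (o, s) (by simp [hs])]
    have hQ' : (Q : ℚ) ≠ 0 := by positivity
    rw [one_div, eq_inv_mul_iff_mul_eq₀ hQ', ht, hpe]
    have h0 := hval none
    simp only [Option.elim_none] at h0
    rw [mul_add, h0]
    have hlin : ∑ i, (e i : ℚ) * (B k *ᵥ x) i = ∑ j, (∑ i, (e i : ℚ) * B k i j) * x j := by
      simp only [Matrix.mulVec, dotProduct, Finset.mul_sum, Finset.sum_mul]
      rw [Finset.sum_comm]
      simp only [mul_assoc]
    rw [hlin, Finset.mul_sum]
    simp only [← mul_assoc]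
    have hj : ∀ j : Fin q, (Q : ℚ) * (∑ i, (e i : ℚ) * B k i j) * x j =
        ∑ s ∈ S, expMono s k * ((z (some j, s) : ℚ) * x j) := by
      intro j
      have h := hval (some j)
      simp only [Option.elim_some] at h
      rw [h, Finset.sum_mul]
      exact Finset.sum_congr rfl fun s _ => by ring
    rw [Finset.sum_congr rfl fun j _ => hj j, Finset.sum_comm]
    simp only [mul_add, Finset.sum_add_distrib, Finset.mul_sum]
    congr 1
    exact Finset.sum_congr rfl fun s _ => mul_comm _ _
  · intro s hs
    have h := hpS s hs
    simp only [S, Finset.mem_biUnion, Finset.mem_univ, true_and] at h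
    obtain ⟨o, ho⟩ := h
    exact hcΛ o _ ho

/-! ## Periodic sequences -/

theorem HasPeriod.of_dvd {α : Type*} {a : ℕ → α} {P P' : ℕ} (h : HasPeriod a P)
    (hd : P + 1 ∣ P' + 1) : HasPeriod a P' := by
  obtain ⟨m, hm⟩ := hd
  have h' : Function.Periodic a (P + 1) := h
  have := h'.nsmul m
  rw [smul_eq_mul, mul_comm, ← hm] at this
  exact this

theorem exists_common_period {ι : Type*} [Fintype ι] {α : ι → Type*} {a : ∀ i, ℕ → α i}
    (h : ∀ i, ∃ P, HasPeriod (a i) P) : ∃ P, ∀ i, HasPeriod (a i) P := by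
  choose P hP using h
  have hpos : 0 < ∏ i, (P i + 1) := Finset.prod_pos fun i _ => Nat.succ_pos _
  refine ⟨∏ i, (P i + 1) - 1, fun i => (hP i).of_dvd ?_⟩
  rw [Nat.sub_add_cancel hpos]
  exact Finset.dvd_prod_of_mem (fun i => P i + 1) (Finset.mem_univ i)

theorem exists_common_period₂ {α β : Type*} {a : ℕ → α} {b : ℕ → β} (ha : ∃ P, HasPeriod a P)
    (hb : ∃ P, HasPeriod b P) : ∃ P, HasPeriod a P ∧ HasPeriod b P := by
  obtain ⟨P, hP⟩ := ha
  obtain ⟨P', hP'⟩ := hb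
  have hpos : 0 < (P + 1) * (P' + 1) := by positivity
  exact ⟨(P + 1) * (P' + 1) - 1,
    hP.of_dvd (by rw [Nat.sub_add_cancel hpos]; exact dvd_mul_right _ _),
    hP'.of_dvd (by rw [Nat.sub_add_cancel hpos]; exact dvd_mul_left _ _)⟩

/-- The residues of `λ ^ k * k ^ d` are eventually periodic. -/
theorem exists_periodic_residue (l : ℤ) (d : ℕ) {M : ℤ} (hM : M ≠ 0) :
    ∃ z : ℕ → ℤ, (∃ P, HasPeriod z P) ∧ ∃ K, ∀ k ≥ K, z k = (l ^ k * (k : ℤ) ^ d) % M := by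
  have : NeZero M.natAbs := ⟨by simpa using hM⟩
  -- Two powers of `l` coincide modulo `M` by the pigeonhole principle. From exponent `a` on, the
  -- powers repeat with period `b - a`.
  obtain ⟨a, b, hab, he⟩ : ∃ a b : ℕ, a < b ∧
      ((l : ZMod M.natAbs) ^ a) = (l : ZMod M.natAbs) ^ b := by
    obtain ⟨x, y, hxy, he⟩ := Finite.exists_ne_map_eq_of_infinite
      (fun k : ℕ => (l : ZMod M.natAbs) ^ k)
    rcases lt_or_gt_of_ne hxy with h | h
    · exact ⟨x, y, h, he⟩
    · exact ⟨y, x, h, he.symm⟩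
  have hstep : ∀ n k : ℕ, a ≤ k → (l : ZMod M.natAbs) ^ (k + n * (b - a)) = (l : ZMod M.natAbs) ^ k := by
    intro n k hk
    induction n with
    | zero => simp
    | succ n ih =>
      rw [← ih]
      obtain ⟨j, rfl⟩ := Nat.exists_eq_add_of_le hk
      rw [show a + j + (n + 1) * (b - a) = b + (j + n * (b - a)) by
        rw [add_mul]; omega, pow_add, ← he, ← pow_add]
      congr 1
      omega
  -- A multiple of `b - a` serves the powers of `l`, a multiple of `|M|` serves `k ^ d`.
  set p := M.natAbs * (b - a) with hp
  have hppos : 0 < p := Nat.mul_pos (Nat.pos_of_ne_zero (by simpa using hM)) (by omega)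
  let g : ℕ → ℤ := fun k => (l ^ k * (k : ℤ) ^ d) % M
  have hg : ∀ k ≥ a, g (k + p) = g k := by
    intro k hk
    change Int.ModEq M _ _
    have hz : (((l ^ (k + p) * ((k + p : ℕ) : ℤ) ^ d : ℤ)) : ZMod M.natAbs) =
        ((l ^ k * (k : ℤ) ^ d : ℤ) : ZMod M.natAbs) := by
      push_cast
      rw [hp, hstep _ k hk]
      simp
    have := (ZMod.intCast_eq_intCast_iff _ _ _).1 hz
    exact (Int.modEq_iff_dvd.2 ((Int.natAbs_dvd).1 (Int.modEq_iff_dvd.1 this)))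
  have hg' : ∀ n k : ℕ, a ≤ k → g (k + n * p) = g k := by
    intro n k hk
    induction n with
    | zero => simp
    | succ n ih =>
      rw [add_mul, one_mul, ← add_assoc, hg _ (by omega), ih]
  -- Shifting by `a * p`, a multiple of the period that is at least `a`, skips the preperiod without
  -- changing later values.
  refine ⟨fun k => g (k + a * p), ⟨p - 1, fun k => ?_⟩, a, fun k hk => hg' a k hk⟩
  have h1 : a ≤ k + a * p := by nlinarith
  rw [Nat.sub_add_cancel hppos]
  change g (k + p + a * p) = g (k + a * p)
  rw [add_right_comm, hg _ h1]

/-! ## Existence of characteristic sequences -/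

/-- The formula is controlled only at integral vectors; rational ones are handled by
`exists_isCharSeq`. Inequalities give period 2 by parity, divisibilities inherit the period of the
residues, and connectives take a common period. -/
theorem exists_charSeq {q : ℕ} {A : Matrix (Fin q) (Fin q) ℚ}
    (hA : ∀ i j, (fun k => (A ^ k) i j) ∈ evExp Set.univ) {P : (Fin q → ℤ) → Prop} (hP : QF P) :
    ∃ (φ : Formula (Fin q)) (H : ℕ → Formula (Fin q)), (∀ w, φ.Holds w ↔ P w) ∧ CharSeq A φ H ∧
      ∃ N, HasPeriod H N := by
  induction hP with
  | le t =>
    obtain ⟨Qe, pe, he, hpe, hoe⟩ := exists_closedForm (Λ := {l | 0 < l}) (fun k => A ^ (2 * k))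
      (by simp) (fun i j => comp_two_mul_add_mem_evExp (hA i j) 0)
      ((Term.const 0).add (t.smul (-1)))
    obtain ⟨Qo, po, ho, hpo, hoo⟩ := exists_closedForm (Λ := {l | 0 < l})
      (fun k => A ^ (2 * k + 1))
      (by simp) (fun i j => comp_two_mul_add_mem_evExp (hA i j) 1)
      ((Term.const 0).add (t.smul (-1)))
    refine ⟨_, _, fun w => ?_, CharSeq.le t (Term.const 0) Qe Qo pe po he ho ⟨hpe, hoe⟩ ⟨hpo, hoo⟩,
      1, fun k => ?_⟩
    · simp [Formula.Holds, Term.eval]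
    · simp [Nat.even_add]
  | dvd n hn t =>
    obtain ⟨Q, p, hp, -, -⟩ := exists_closedForm (fun k => A ^ k) (Set.mem_univ 1) hA t
    have hQn : (Q : ℤ) * n ≠ 0 := mul_ne_zero (by exact_mod_cast hp.1.ne') hn
    choose z hz hz' using fun i : Fin p.length =>
      exists_periodic_residue (p.get i).1 (p.get i).2.1 hQn
    refine ⟨_, _, fun w => ?_, CharSeq.dvd n t Q p hp z hz hz', ?_⟩
    · simp [Formula.Holds, dvd_def]
    · obtain ⟨N, hN⟩ := exists_common_period hz
      refine ⟨N, fun k => ?_⟩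
      simp only [hN _ k]
  | and _ _ h h' =>
    obtain ⟨φ, H, e, hc, hp⟩ := h
    obtain ⟨φ', H', e', hc', hp'⟩ := h'
    obtain ⟨N, hN, hN'⟩ := exists_common_period₂ hp hp'
    exact ⟨φ.and φ', _, fun w => and_congr (e w) (e' w), CharSeq.and _ _ _ _ hc hc', N,
      fun k => by simp only [hN k, hN' k]⟩
  | or _ _ h h' =>
    obtain ⟨φ, H, e, hc, hp⟩ := h
    obtain ⟨φ', H', e', hc', hp'⟩ := h'
    obtain ⟨N, hN, hN'⟩ := exists_common_period₂ hp hp'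
    exact ⟨φ.or φ', _, fun w => or_congr (e w) (e' w), CharSeq.or _ _ _ _ hc hc', N,
      fun k => by simp only [hN k, hN' k]⟩
  | not _ h =>
    obtain ⟨φ, H, e, hc, N, hN⟩ := h
    exact ⟨φ.not, _, fun w => not_congr (e w), CharSeq.not _ _ hc, N, fun k => by simp only [hN k]⟩

/-- Conjunction with `1 ∣ wᵢ` for all `i` makes a formula false at rational vectors that are not
integral. -/
theorem exists_isCharSeq {q : ℕ} {A : Matrix (Fin q) (Fin q) ℚ}
    (hA : ∀ i j, (fun k => (A ^ k) i j) ∈ evExp Set.univ) {P : (Fin q → ℤ) → Prop} (hP : QF P) :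
    ∃ (φ : Formula (Fin q)) (H : ℕ → Formula (Fin q)),
      (∀ w : Fin q → ℚ, φ.Holds w ↔ ∃ w' : Fin q → ℤ, (∀ i, w i = w' i) ∧ P w') ∧
      IsCharSeq φ A H ∧ ∃ N, HasPeriod H N := by
  have hint : ∀ l : List (Fin q), ∃ (φ : Formula (Fin q)) (H : ℕ → Formula (Fin q)),
      (∀ w : Fin q → ℚ, φ.Holds w ↔ ∀ i ∈ l, ∃ z : ℤ, w i = z) ∧ CharSeq A φ H ∧
        ∃ N, HasPeriod H N := by
    intro l
    induction l with
    | nil =>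
      -- The empty conjunction must be true at all rational vectors, whereas `φ` is known only at
      -- integral ones; `φ ∨ ¬ φ` is true everywhere.
      obtain ⟨φ, H, -, hc, hp⟩ := exists_charSeq hA QF.of_true
      obtain ⟨N, hN⟩ := hp
      exact ⟨_, _, fun w => by simp [Formula.Holds, em],
        CharSeq.or _ _ _ _ hc (CharSeq.not _ _ hc), N, fun k => by simp only [hN k]⟩
    | cons i l ih =>
      obtain ⟨φ, H, e, hc, hp⟩ := ih
      obtain ⟨Q, p, hp', -, -⟩ := exists_closedForm (fun k => A ^ k) (Set.mem_univ 1) hA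
        (Term.var i)
      have hQn : (Q : ℤ) * 1 ≠ 0 := mul_ne_zero (by exact_mod_cast hp'.1.ne') one_ne_zero
      choose z hz hz' using fun i : Fin p.length =>
        exists_periodic_residue (p.get i).1 (p.get i).2.1 hQn
      obtain ⟨N, hN, hN'⟩ := exists_common_period₂ hp (exists_common_period hz |>.imp
        fun N hN => (show HasPeriod (fun k i => z i k) N from fun k => funext fun i => hN i k))
      refine ⟨_, _, fun w => ?_, CharSeq.and _ _ _ _ (CharSeq.dvd 1 (Term.var i) Q p hp' z hz hz')
        hc, N, fun k => ?_⟩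
      · simp [Formula.Holds, e, Term.eval]
      · have h := fun i => congrFun (hN' k) i
        simp only [hN k, h]
  obtain ⟨φ, H, e, hc, hp⟩ := exists_charSeq hA hP
  obtain ⟨φ', H', e', hc', hp'⟩ := hint (List.finRange q)
  obtain ⟨N, hN, hN'⟩ := exists_common_period₂ hp hp'
  refine ⟨φ'.and φ, _, fun w => ?_, ⟨_, fun w => Iff.rfl, CharSeq.and _ _ _ _ hc' hc⟩, N,
    fun k => by simp only [hN k, hN' k]⟩
  simp only [Formula.Holds, e', List.mem_finRange, true_implies]
  constructor
  · rintro ⟨h1, h2⟩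
    choose w' hw' using h1
    obtain rfl : w = fun i => (w' i : ℚ) := funext hw'
    exact ⟨w', fun i => rfl, (e w').1 ((Formula.holds_cast φ w').1 h2)⟩
  · rintro ⟨w', hw', h⟩
    obtain rfl : w = fun i => (w' i : ℚ) := funext hw'
    exact ⟨fun i => ⟨w' i, rfl⟩, (Formula.holds_cast φ w').2 ((e w').2 h)⟩

end LIA

namespace LIA

/-! ## Soundness of characteristic sequences -/

/-- A larger base beats every power of k; for equal bases the degrees decide. -/
theorem isLittleO_expMono {s s' : ℤ × ℕ} (h0 : 0 < s'.1)
    (h : s'.1 < s.1 ∨ (s.1 = s'.1 ∧ s'.2 < s.2)) :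
    (fun k => (expMono s' k : ℝ)) =o[atTop] fun k => (expMono s k : ℝ) := by
  obtain ⟨l, d⟩ := s
  obtain ⟨l', d'⟩ := s'
  simp only [expMono, Rat.cast_mul, Rat.cast_pow, Rat.cast_intCast, Rat.cast_natCast] at h h0 ⊢
  rcases h with h | ⟨rfl, h⟩
  · have h1 : (fun k : ℕ => (k : ℝ) ^ d' * (l' : ℝ) ^ k) =o[atTop] fun k => (l : ℝ) ^ k := by
      refine isLittleO_pow_const_mul_const_pow_const_pow_of_norm_lt d' ?_
      have h2 : (0 : ℝ) < l' := by exact_mod_cast h0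
      rw [Real.norm_eq_abs, abs_of_pos h2]
      exact_mod_cast h
    have h2 : (fun k : ℕ => (l : ℝ) ^ k) =O[atTop] fun k : ℕ => (l : ℝ) ^ k * (k : ℝ) ^ d := by
      refine Asymptotics.IsBigO.of_bound 1 ?_
      filter_upwards [eventually_ge_atTop 1] with k hk
      rw [one_mul, norm_mul]
      refine le_mul_of_one_le_right (norm_nonneg _) ?_
      rw [norm_pow]
      exact one_le_pow₀ (by simpa using hk)
    simpa only [mul_comm] using h1.trans_isBigO h2
  · have h1 : (fun k : ℕ => (k : ℝ) ^ d') =o[atTop] fun k : ℕ => (k : ℝ) ^ d :=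
      (Asymptotics.isLittleO_pow_pow_atTop_of_lt h).comp_tendsto tendsto_natCast_atTop_atTop
    exact (Asymptotics.isBigO_refl (fun k : ℕ => (l : ℝ) ^ k) atTop).mul_isLittleO h1

theorem ExpPoly.isLittleO_eval {X : Type} (p : ExpPoly X) (w : X → ℚ) (s : ℤ × ℕ)
    (h0 : ∀ s' ∈ p, 0 < s'.1)
    (h : ∀ s' ∈ p, s'.1 < s.1 ∨ (s.1 = s'.1 ∧ s'.2.1 < s.2)) :
    (fun k => (p.eval w k : ℝ)) =o[atTop] fun k => (expMono s k : ℝ) := by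
  induction p with
  | nil => simp [ExpPoly.eval]
  | cons s' p ih =>
    have h1 := isLittleO_expMono (s := s) (s' := (s'.1, s'.2.1)) (h0 s' (by simp)) (h s' (by simp))
    have h2 := ih (fun s hs => h0 s (by simp [hs])) (fun s hs => h s (by simp [hs]))
    refine ((h1.const_mul_left ((s'.2.2.eval w : ℚ) : ℝ)).add h2).congr_left fun k => ?_
    simp only [ExpPoly.eval, List.map_cons, List.sum_cons, Rat.cast_add, Rat.cast_mul, expMono]
    ring

/-- Dominant term analysis decides the eventual sign of an exponential-polynomial. -/
theorem ExpPoly.eventually_holds_dta_iff {X : Type} (p : ExpPoly X) (hp : p.IsDominanceOrdered)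
    (w : X → ℤ) : ∀ᶠ k in atTop, (p.dta.Holds (fun x => (w x : ℚ)) ↔
      0 ≤ p.eval (fun x => (w x : ℚ)) k) := by
  induction p with
  | nil =>
    exact Eventually.of_forall fun k => iff_of_true (Formula.holds_verum _)
      (by simp [ExpPoly.eval])
  | cons s p ih =>
    obtain ⟨h0, hs⟩ := hp
    rw [List.pairwise_cons] at hs
    have ih' := ih ⟨fun s hs => h0 s (by simp [hs]), hs.2⟩
    have hlo := ExpPoly.isLittleO_eval p (fun x => (w x : ℚ)) (s.1, s.2.1)
      (fun s hs => h0 s (by simp [hs])) hs.1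
    -- At an integral vector the leading coefficient is an integer, so if it is nonzero the leading
    -- summand is at least its monomial in absolute value. A tail below half the monomial cannot
    -- change the sign.
    have hbd := hlo.bound (c := 1 / 2) (by norm_num)
    have hs0 : 0 < s.1 := h0 s (by simp)
    filter_upwards [ih', hbd, eventually_ge_atTop 1] with k hk hb hk1
    have hmono : 0 < expMono (s.1, s.2.1) k := by
      have : (0 : ℚ) < s.1 := by exact_mod_cast hs0
      have : (0 : ℚ) < k := by exact_mod_cast hk1
      simp only [expMono]
      positivity
    have hb' : |ExpPoly.eval p (fun x => (w x : ℚ)) k| ≤ 1 / 2 * expMono (s.1, s.2.1) k := by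
      rw [Real.norm_eq_abs, Real.norm_eq_abs, ← Rat.cast_abs, ← Rat.cast_abs,
        abs_of_pos hmono] at hb
      have : ((|ExpPoly.eval p (fun x => (w x : ℚ)) k| : ℚ) : ℝ) ≤
          ((1 / 2 * expMono (s.1, s.2.1) k : ℚ) : ℝ) := by push_cast at hb ⊢; exact hb
      exact_mod_cast this
    have heval : ExpPoly.eval (s :: p) (fun x => (w x : ℚ)) k =
        expMono (s.1, s.2.1) k * (s.2.2.eval w : ℤ) + ExpPoly.eval p (fun x => (w x : ℚ)) k := by
      simp [ExpPoly.eval, expMono, Term.eval_cast]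
    have hdta : (ExpPoly.dta (s :: p)).Holds (fun x => (w x : ℚ)) ↔
        (1 ≤ s.2.2.eval w ∨ (s.2.2.eval w = 0 ∧ (ExpPoly.dta p).Holds (fun x => (w x : ℚ)))) := by
      simp only [ExpPoly.dta, Formula.Holds, Formula.holds_eqZero, Term.eval_cast]
      simp only [Term.eval]
      norm_cast
    rw [hdta, heval]
    obtain ⟨hb1, hb2⟩ := abs_le.1 hb'
    rcases lt_trichotomy (s.2.2.eval w) 0 with h | h | h
    · refine iff_of_false (by omega) (not_le.2 ?_)
      have : ((s.2.2.eval w : ℤ) : ℚ) ≤ -1 := by exact_mod_cast (by omega : s.2.2.eval w ≤ -1)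
      nlinarith
    · simp [h, hk]
    · refine iff_of_true (by omega) ?_
      have : (1 : ℚ) ≤ ((s.2.2.eval w : ℤ) : ℚ) := by exact_mod_cast h
      nlinarith

theorem eventually_atTop_of_two_mul {p : ℕ → Prop} (he : ∀ᶠ k in atTop, p (2 * k))
    (ho : ∀ᶠ k in atTop, p (2 * k + 1)) : ∀ᶠ k in atTop, p k := by
  obtain ⟨K, hK⟩ := eventually_atTop.1 he
  obtain ⟨K', hK'⟩ := eventually_atTop.1 ho
  filter_upwards [eventually_ge_atTop (2 * K + 2 * K' + 2)] with k hk
  rcases Nat.even_or_odd' k with ⟨m, rfl | rfl⟩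
  · exact hK m (by omega)
  · exact hK' m (by omega)

/-- At an integral vector `w`, the entries of a characteristic sequence eventually agree with the
truth values of the formula along the orbit of `w`. -/
theorem CharSeq.eventually_holds_iff {q : ℕ} {A : Matrix (Fin q) (Fin q) ℚ} {φ : Formula (Fin q)}
    {H : ℕ → Formula (Fin q)} (h : CharSeq A φ H) (w : Fin q → ℤ) :
    ∀ᶠ k in atTop, ((H k).Holds (fun i => (w i : ℚ)) ↔
      φ.Holds (A ^ k *ᵥ fun i => (w i : ℚ))) := by
  induction h with
  | le t₁ t₂ Qe Qo pe po he ho he' ho' =>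
    have key : ∀ {Q : ℕ} {p : ExpPoly (Fin q)} {B : ℕ → Matrix (Fin q) (Fin q) ℚ},
        ExpPoly.IsClosedForm B (t₂.add (t₁.smul (-1))) Q p → p.IsDominanceOrdered →
        ∀ᶠ k in atTop, (p.dta.Holds (fun i => (w i : ℚ)) ↔
          (Formula.le t₁ t₂).Holds (B k *ᵥ fun i => (w i : ℚ))) := by
      rintro Q p B ⟨hQ, K, hK⟩ hp
      filter_upwards [p.eventually_holds_dta_iff hp w, eventually_ge_atTop K] with k h1 h2
      rw [h1]
      have h3 := hK k h2 (fun i => (w i : ℚ))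
      simp only [Term.eval] at h3
      have hQ' : (0 : ℚ) < 1 / Q := by positivity
      rw [Formula.Holds, ← mul_nonneg_iff_of_pos_left hQ', ← h3]
      constructor <;> intro h <;> push_cast at * <;> linarith
    refine eventually_atTop_of_two_mul ?_ ?_
    · filter_upwards [key he he'] with k hk
      simpa using hk
    · filter_upwards [key ho ho'] with k hk
      simpa using hk
  | dvd n t Q p hp z hz hz' =>
    obtain ⟨hQ, K, hK⟩ := hp
    have hz'' : ∀ᶠ k in atTop, ∀ i, z i k =
        ((p.get i).1 ^ k * (k : ℤ) ^ (p.get i).2.1) % ((Q : ℤ) * n) :=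
      eventually_all.2 fun i => eventually_atTop.2 (hz' i)
    filter_upwards [hz'', eventually_ge_atTop K] with k h1 h2
    have h3 := hK k h2 (fun i => (w i : ℚ))
    let S : ℤ := ∑ i : Fin p.length,
      (p.get i).1 ^ k * (k : ℤ) ^ (p.get i).2.1 * (p.get i).2.2.eval w
    have hS : p.eval (fun i => (w i : ℚ)) k = S := by
      simp only [ExpPoly.eval, S, Int.cast_sum]
      rw [← List.sum_ofFn]
      congr 1
      conv_lhs => rw [← List.ofFn_get p, List.map_ofFn]
      congr 1
      ext i
      simp [Term.eval_cast]
    let S' : ℤ := ∑ i : Fin p.length, z i k * (p.get i).2.2.eval w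
    have hS' : (Term.sum (List.ofFn (fun i => Term.smul (z i k) (p.get i).2.2))).eval
        (fun i => (w i : ℚ)) = S' := by
      simp only [Term.eval_sum, List.map_ofFn, List.sum_ofFn, S', Int.cast_sum]
      refine Finset.sum_congr rfl fun i _ => ?_
      simp [Term.eval, Term.eval_cast]
    -- At an integral vector all `aᵢ(w)` are integers, so replacing the monomials by their residues
    -- preserves divisibility by `Q * n`.
    have hmod : (Q : ℤ) * n ∣ S' ↔ (Q : ℤ) * n ∣ S := by
      refine Int.ModEq.dvd_iff (?_ : S' ≡ S [ZMOD _])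
      refine Int.ModEq.sum fun i _ => ?_
      rw [h1 i]
      exact (Int.mod_modEq _ _).mul_right _
    have hl : (Formula.dvd ((Q : ℤ) * n) (Term.sum (List.ofFn
        (fun i => Term.smul (z i k) (p.get i).2.2)))).Holds (fun i => (w i : ℚ)) ↔
        (Q : ℤ) * n ∣ S' := by
      simp only [Formula.Holds, hS', dvd_def]
      exact exists_congr fun z => by norm_cast
    rw [hl, hmod, Formula.Holds, h3, hS, dvd_def]
    refine exists_congr fun y => ?_
    have hQ' : (Q : ℚ) ≠ 0 := by positivity
    rw [one_div, inv_mul_eq_iff_eq_mul₀ hQ', ← mul_assoc]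
    norm_cast
  | and φ ψ H H' h h' ih ih' =>
    filter_upwards [ih, ih'] with k h h'
    exact and_congr h h'
  | or φ ψ H H' h h' ih ih' =>
    filter_upwards [ih, ih'] with k h h'
    exact or_congr h h'
  | not φ H h ih =>
    filter_upwards [ih] with k h
    exact not_congr h

theorem HasPeriod.add_mul {α : Type*} {a : ℕ → α} {P : ℕ} (h : HasPeriod a P) (n k : ℕ) :
    a (k + n * (P + 1)) = a k := by
  have h' : Function.Periodic a (P + 1) := h
  exact h'.nat_mul n k

/-- All entries of a periodic characteristic sequence hold at an integral vector if and only if the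
formula eventually holds along its orbit. -/
theorem IsCharSeq.forall_holds_iff {q : ℕ} {A : Matrix (Fin q) (Fin q) ℚ} {G : Formula (Fin q)}
    {H : ℕ → Formula (Fin q)} (h : IsCharSeq G A H) {P : ℕ} (hP : HasPeriod H P) (w : Fin q → ℤ) :
    (∀ i : Fin (P + 1), (H i).Holds w) ↔
      ∀ᶠ k in atTop, G.Holds (A ^ k *ᵥ fun i => (w i : ℚ)) := by
  obtain ⟨G', hG, hc⟩ := h
  have hev := hc.eventually_holds_iff w
  simp only [hG, Formula.holds_cast] at hev
  constructor
  · intro hH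
    filter_upwards [hev] with k hk
    refine hk.1 ?_
    have := hH ⟨k % (P + 1), Nat.mod_lt _ (Nat.succ_pos _)⟩
    rw [← hP.add_mul (k / (P + 1)) (k % (P + 1)), mul_comm, Nat.mod_add_div] at this
    exact this
  · intro hGe i
    -- The entry `H i` recurs at the index `i + K * (P + 1)`, which is past the threshold.
    obtain ⟨K, hK⟩ := eventually_atTop.1 (hev.and hGe)
    obtain ⟨h1, h2⟩ := hK (i + K * (P + 1)) (by nlinarith)
    rw [hP.add_mul] at h1
    exact h1.2 h2

end LIA

namespace TransitionSystem

variable {T U W : TransitionSystem}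

/-! ## Simulations and `ω`-domains -/

theorem omegaMap_spec (hL : T.IsLinear) (hD : T.IsDeterministic) (x : omegaSubspace hL) :
    ((x : T.State), (omegaMap hL hD x : T.State)) ∈ T.Rel :=
  (exists_succ_of_mem_omegaDomain x.2).choose_spec.2

theorem IsSimulation.mem_omegaDomain {s : T.State →ₗ[ℚ] U.State} (hs : T.IsSimulation U s)
    {x : T.State} (hx : x ∈ T.omegaDomain) : s x ∈ U.omegaDomain := by
  obtain ⟨y, rfl, hy⟩ := hx
  exact ⟨fun k => s (y k), rfl, fun k => hs _ _ (hy k)⟩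

/-- The restriction of a linear simulation to the `ω`-domains. -/
def omegaLift (hT : T.IsLinear) (hU : U.IsLinear) (s : T.State →ₗ[ℚ] U.State)
    (hs : T.IsSimulation U s) : omegaSubspace hT →ₗ[ℚ] omegaSubspace hU :=
  s.restrict (p := omegaSubspace hT) (q := omegaSubspace hU) fun _ hx => hs.mem_omegaDomain hx

/-- Both composites send x to a successor of s(x), and determinism leaves only one. -/
theorem omegaLift_comp_omegaMap (hT : T.IsLinear) (hDT : T.IsDeterministic) (hU : U.IsLinear)
    (hDU : U.IsDeterministic) (s : T.State →ₗ[ℚ] U.State) (hs : T.IsSimulation U s) :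
    omegaLift hT hU s hs ∘ₗ omegaMap hT hDT = omegaMap hU hDU ∘ₗ omegaLift hT hU s hs := by
  ext x
  exact hDU _ _ _ (hs _ _ (omegaMap_spec hT hDT x)) (omegaMap_spec hU hDU (omegaLift hT hU s hs x))

end TransitionSystem

/-! ### Intertwining maps and annihilating polynomials -/

section Intertwine

variable {M N : Type*} [AddCommGroup M] [Module ℚ M] [AddCommGroup N] [Module ℚ N]

theorem Module.End.comp_pow_of_comp {f : Module.End ℚ M} {g : Module.End ℚ N} {u : M →ₗ[ℚ] N}
    (h : u ∘ₗ f = g ∘ₗ u) (n : ℕ) (x : M) : u ((f ^ n) x) = (g ^ n) (u x) := by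
  induction n generalizing x with
  | zero => simp
  | succ n ih =>
    rw [pow_succ, pow_succ, Module.End.mul_apply, Module.End.mul_apply, ih]
    exact congrArg _ (LinearMap.congr_fun h x)

theorem Module.End.comp_aeval_of_comp {f : Module.End ℚ M} {g : Module.End ℚ N} {u : M →ₗ[ℚ] N}
    (h : u ∘ₗ f = g ∘ₗ u) (p : Polynomial ℚ) (x : M) :
    u (Polynomial.aeval f p x) = Polynomial.aeval g p (u x) := by
  induction p using Polynomial.induction_on' with
  | add p q hp hq => simp [hp, hq]
  | monomial n a => simp [Polynomial.aeval_monomial, Module.End.comp_pow_of_comp h]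

/-- The complex roots of the characteristic polynomial are roots of every annihilating
polynomial. -/
theorem LinearMap.aeval_eq_zero_of_charpoly_root [FiniteDimensional ℚ M] (f : Module.End ℚ M)
    (p : Polynomial ℚ) (hp : Polynomial.aeval f p = 0) (z : ℂ)
    (hz : Polynomial.aeval z f.charpoly = 0) : Polynomial.aeval z p = 0 := by
  classical
  let b := Module.finBasis ℚ M
  let A := LinearMap.toMatrix b b f
  let A' : Matrix _ _ ℂ := A.map (algebraMap ℚ ℂ)
  have hA : Polynomial.aeval A p = 0 := by
    have h := congrArg (LinearMap.toMatrixAlgEquiv b) hp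
    rwa [← Polynomial.aeval_algHom_apply, map_zero] at h
  have hA' : Polynomial.aeval A' (p.map (algebraMap ℚ ℂ)) = 0 := by
    rw [Polynomial.aeval_map_algebraMap]
    have h := congrArg ((Algebra.ofId ℚ ℂ).mapMatrix) hA
    rw [← Polynomial.aeval_algHom_apply, map_zero] at h
    exact h
  have hroot : z ∈ spectrum ℂ A' := by
    rw [Matrix.mem_spectrum_iff_isRoot_charpoly, Matrix.charpoly_map, Polynomial.IsRoot,
      Polynomial.eval_map_algebraMap, LinearMap.charpoly_toMatrix]
    exact hz
  -- Spectral mapping: p(z) lies in the spectrum of p(A') = 0, which is {0} in a nontrivial ring. In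
  -- dimension zero the spectrum is empty and there is no root z.
  have h := spectrum.subset_polynomial_aeval A' (p.map (algebraMap ℚ ℂ)) ⟨z, hroot, rfl⟩
  rw [hA'] at h
  have : Nontrivial (Matrix (Fin (Module.finrank ℚ M)) (Fin (Module.finrank ℚ M)) ℂ) := by
    by_contra hn
    rw [not_nontrivial_iff_subsingleton] at hn
    rw [spectrum.of_subsingleton] at hroot
    exact hroot
  rw [spectrum.zero_eq, Set.mem_singleton_iff] at h
  simpa [Polynomial.eval_map_algebraMap] using h

end Intertwine

/-! ### Closure of rational-spectrum systems under joint embeddings -/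

namespace TransitionSystem

variable {T U W W₁ W₂ : TransitionSystem}

/-- A linear system that maps jointly injectively into two deterministic systems with rational
spectrum has these properties as well. -/
theorem IsQDLTS.of_jointly_injective (hU : U.IsLinear) {f₁ : U.State →ₗ[ℚ] W₁.State}
    {f₂ : U.State →ₗ[ℚ] W₂.State} (h₁ : U.IsSimulation W₁ f₁) (h₂ : U.IsSimulation W₂ f₂)
    (hf : ∀ x y, f₁ x = f₁ y → f₂ x = f₂ y → x = y) (hW₁ : W₁.IsQDLTS) (hW₂ : W₂.IsQDLTS) :
    U.IsQDLTS := by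
  obtain ⟨hL₁, hD₁, hr₁⟩ := hW₁
  obtain ⟨hL₂, hD₂, hr₂⟩ := hW₂
  have hD : U.IsDeterministic := fun x y z hy hz =>
    hf _ _ (hD₁ _ _ _ (h₁ _ _ hy) (h₁ _ _ hz)) (hD₂ _ _ _ (h₂ _ _ hy) (h₂ _ _ hz))
  refine ⟨hU, hD, fun z hz => ?_⟩
  -- The product of the two characteristic polynomials annihilates the ω-map of `U`: after either
  -- embedding, one of the factors vanishes by Cayley-Hamilton.
  have key := LinearMap.aeval_eq_zero_of_charpoly_root (omegaMap hU hD)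
    ((omegaMap hL₁ hD₁).charpoly * (omegaMap hL₂ hD₂).charpoly) ?_ z hz
  · rw [map_mul] at key
    rcases mul_eq_zero.1 key with h | h
    · exact hr₁ z h
    · exact hr₂ z h
  · ext x
    refine hf _ _ ?_ ?_
    · have h := Module.End.comp_aeval_of_comp (omegaLift_comp_omegaMap hU hD hL₁ hD₁ f₁ h₁)
        ((omegaMap hL₁ hD₁).charpoly * (omegaMap hL₂ hD₂).charpoly) x
      rw [map_mul (Polynomial.aeval (omegaMap hL₁ hD₁)), LinearMap.aeval_self_charpoly,
        zero_mul] at h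
      exact (congrArg Subtype.val h).trans (map_zero f₁).symm
    · have h := Module.End.comp_aeval_of_comp (omegaLift_comp_omegaMap hU hD hL₂ hD₂ f₂ h₂)
        ((omegaMap hL₁ hD₁).charpoly * (omegaMap hL₂ hD₂).charpoly) x
      rw [map_mul (Polynomial.aeval (omegaMap hL₂ hD₂)), LinearMap.aeval_self_charpoly,
        mul_zero] at h
      exact (congrArg Subtype.val h).trans (map_zero f₂).symm

/-- The homogenization of a linear map. -/
def homogMap (s : T.State →ₗ[ℚ] U.State) : T.homog.State →ₗ[ℚ] U.homog.State :=
  (s.prodMap LinearMap.id : T.State × ℚ →ₗ[ℚ] U.State × ℚ)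

theorem homogMap_apply (s : T.State →ₗ[ℚ] U.State) (x : T.State) (c : ℚ) :
    homogMap s (x, c) = (s x, c) := rfl

theorem IsSimulation.homog {s : T.State →ₗ[ℚ] U.State} (hs : T.IsSimulation U s) :
    T.homog.IsSimulation U.homog (homogMap s) := by
  intro x x' h
  have hle : Submodule.span ℚ ((fun r : T.State × T.State => ((r.1, (1 : ℚ)), (r.2, (1 : ℚ)))) ''
      T.Rel) ≤ (Submodule.span ℚ ((fun r : U.State × U.State =>
        ((r.1, (1 : ℚ)), (r.2, (1 : ℚ)))) '' U.Rel)).comap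
      ((s.prodMap LinearMap.id).prodMap (s.prodMap LinearMap.id)) := by
    refine Submodule.span_le.2 ?_
    rintro _ ⟨r, hr, rfl⟩
    exact Submodule.subset_span ⟨(s r.1, s r.2), hs _ _ hr, rfl⟩
  exact hle h

theorem IsQDATS.of_jointly_injective (hU : U.IsAffine) {f₁ : U.State →ₗ[ℚ] W₁.State}
    {f₂ : U.State →ₗ[ℚ] W₂.State} (h₁ : U.IsSimulation W₁ f₁) (h₂ : U.IsSimulation W₂ f₂)
    (hf : ∀ x y, f₁ x = f₁ y → f₂ x = f₂ y → x = y) (hW₁ : W₁.IsQDATS) (hW₂ : W₂.IsQDATS) :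
    U.IsQDATS := by
  refine ⟨hU, fun x y z hy hz => hf _ _ (hW₁.2.1 _ _ _ (h₁ _ _ hy) (h₁ _ _ hz))
    (hW₂.2.1 _ _ _ (h₂ _ _ hy) (h₂ _ _ hz)), ?_⟩
  refine IsQDLTS.of_jointly_injective U.homog_isLinear h₁.homog h₂.homog ?_ hW₁.2.2 hW₂.2.2
  rintro ⟨x, c⟩ ⟨y, d⟩ h h'
  exact Prod.ext (hf x y (congrArg (fun p : W₁.State × ℚ => p.1) h)
    (congrArg (fun p : W₂.State × ℚ => p.1) h')) (congrArg (fun p : W₁.State × ℚ => p.2) h)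

/-- Only the homogenizing coordinate is left, and transitions preserve it. The ω-map is the
identity, so 1 is the only possible eigenvalue. -/
theorem homog_isQDLTS_of_subsingleton [Subsingleton T.State] : T.homog.IsQDLTS := by
  have hrel : ∀ x x' : T.homog.State, (x, x') ∈ T.homog.Rel → x = x' := by
    intro x x' h
    have hle : Submodule.span ℚ ((fun r : T.State × T.State =>
        ((r.1, (1 : ℚ)), (r.2, (1 : ℚ)))) '' T.Rel) ≤
        LinearMap.ker (LinearMap.fst ℚ (T.State × ℚ) (T.State × ℚ) -
          LinearMap.snd ℚ (T.State × ℚ) (T.State × ℚ)) := by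
      refine Submodule.span_le.2 ?_
      rintro _ ⟨r, hr, rfl⟩
      simp [Subsingleton.elim r.1 r.2]
    have := hle h
    exact sub_eq_zero.1 (LinearMap.mem_ker.1 this)
  have hD : T.homog.IsDeterministic := fun x y z hy hz => (hrel _ _ hy).symm.trans (hrel _ _ hz)
  refine ⟨T.homog_isLinear, hD, fun z hz => ⟨1, ?_⟩⟩
  have h := LinearMap.aeval_eq_zero_of_charpoly_root _ (Polynomial.X - 1) ?_ z hz
  · simp only [map_sub, Polynomial.aeval_X, map_one] at h
    simpa using (sub_eq_zero.1 h).symm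
  · rw [map_sub, Polynomial.aeval_X, map_one, sub_eq_zero]
    exact LinearMap.ext fun x => Subtype.ext (hrel _ _ (omegaMap_spec _ _ x)).symm

/-! ## Reflections -/

/-- The affine hull of the image of `T` in the quotient of the state space by `K`. -/
def affineQuotient (T : TransitionSystem) (K : Submodule ℚ T.State) : TransitionSystem where
  State := T.State ⧸ K
  Rel := affineSpan ℚ ((fun r : T.State × T.State => (K.mkQ r.1, K.mkQ r.2)) '' T.Rel)

theorem affineQuotient_isAffine (K : Submodule ℚ T.State) : (T.affineQuotient K).IsAffine :=
  ⟨_, rfl⟩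

/-- The projection to the quotient. -/
def toAffineQuotient (K : Submodule ℚ T.State) : T.State →ₗ[ℚ] (T.affineQuotient K).State :=
  K.mkQ

theorem isSimulation_toAffineQuotient (K : Submodule ℚ T.State) :
    T.IsSimulation (T.affineQuotient K) (toAffineQuotient K) :=
  fun x x' h => subset_affineSpan ℚ _ ⟨(x, x'), h, rfl⟩

theorem toAffineQuotient_surjective (K : Submodule ℚ T.State) :
    Function.Surjective (toAffineQuotient K) := K.mkQ_surjective

theorem ker_toAffineQuotient (K : Submodule ℚ T.State) :
    LinearMap.ker (toAffineQuotient K) = K := K.ker_mkQ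

/-- The preimage of an affine relation is affine, so it contains the affine hull as soon as it
contains the images of the transitions. -/
theorem isSimulation_of_comp_toAffineQuotient {K : Submodule ℚ T.State} (hW : W.IsAffine)
    (f : (T.affineQuotient K).State →ₗ[ℚ] W.State)
    (h : T.IsSimulation W (f ∘ₗ toAffineQuotient K)) : (T.affineQuotient K).IsSimulation W f := by
  obtain ⟨L, hL⟩ := hW
  let f' : T.State ⧸ K →ₗ[ℚ] W.State := f
  have hle : affineSpan ℚ ((fun r : T.State × T.State => (K.mkQ r.1, K.mkQ r.2)) '' T.Rel) ≤
      L.comap (f'.prodMap f').toAffineMap := by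
    refine affineSpan_le.2 ?_
    rintro _ ⟨r, hr, rfl⟩
    have := h _ _ hr
    rw [← hL] at this
    exact this
  intro x x' hx
  rw [← hL]
  exact hle hx

/-- The map induced on the quotient. -/
def affineQuotientLift {K : Submodule ℚ T.State} (s : T.State →ₗ[ℚ] W.State)
    (h : K ≤ LinearMap.ker s) : (T.affineQuotient K).State →ₗ[ℚ] W.State :=
  (K.liftQ s h : T.State ⧸ K →ₗ[ℚ] W.State)

theorem affineQuotientLift_comp {K : Submodule ℚ T.State} (s : T.State →ₗ[ℚ] W.State)
    (h : K ≤ LinearMap.ker s) : affineQuotientLift s h ∘ₗ toAffineQuotient K = s :=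
  K.liftQ_mkQ s h

theorem isSimulation_affineQuotientLift {K : Submodule ℚ T.State} (hW : W.IsAffine)
    {s : T.State →ₗ[ℚ] W.State} (hs : T.IsSimulation W s) (h : K ≤ LinearMap.ker s) :
    (T.affineQuotient K).IsSimulation W (affineQuotientLift s h) :=
  isSimulation_of_comp_toAffineQuotient hW _ (by rwa [affineQuotientLift_comp])

/-- The maps induced by s₁ and s₂ are jointly injective on the quotient by the intersection of their
kernels. -/
theorem IsQDATS.affineQuotient_inf {s₁ : T.State →ₗ[ℚ] W₁.State} {s₂ : T.State →ₗ[ℚ] W₂.State}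
    (h₁ : T.IsSimulation W₁ s₁) (h₂ : T.IsSimulation W₂ s₂) (hW₁ : W₁.IsQDATS)
    (hW₂ : W₂.IsQDATS) :
    (T.affineQuotient (LinearMap.ker s₁ ⊓ LinearMap.ker s₂)).IsQDATS := by
  refine IsQDATS.of_jointly_injective (affineQuotient_isAffine _)
    (isSimulation_affineQuotientLift hW₁.1 h₁ inf_le_left)
    (isSimulation_affineQuotientLift hW₂.1 h₂ inf_le_right) ?_ hW₁ hW₂
  intro x y hx hy
  obtain ⟨x, rfl⟩ := toAffineQuotient_surjective _ x
  obtain ⟨y, rfl⟩ := toAffineQuotient_surjective _ y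
  have hx' : s₁ x = s₁ y := hx
  have hy' : s₂ x = s₂ y := hy
  rw [← sub_eq_zero, ← map_sub, ← LinearMap.mem_ker, ker_toAffineQuotient]
  exact ⟨by simp [hx'], by simp [hy']⟩

theorem affineQuotient_top_isQDATS : (T.affineQuotient ⊤).IsQDATS := by
  have : Subsingleton (T.affineQuotient ⊤).State :=
    inferInstanceAs (Subsingleton (T.State ⧸ (⊤ : Submodule ℚ T.State)))
  exact ⟨affineQuotient_isAffine _, fun _ _ _ _ _ => Subsingleton.elim _ _,
    homog_isQDLTS_of_subsingleton⟩

variable (T) in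
-- Among the subspaces with an admissible quotient, a minimal one K exists by finite dimension. K ∩
-- ker t is admissible too for every simulation t into the class, so minimality gives K ≤ ker t, and
-- t factors through the quotient. Surjectivity of the projection gives uniqueness.
theorem exists_isReflection : ∃ (V : TransitionSystem) (s : T.State →ₗ[ℚ] V.State),
    T.IsReflection V IsQDATS s := by
  obtain ⟨K, hK, hmin⟩ := wellFounded_lt.has_min
    {K : Submodule ℚ T.State | (T.affineQuotient K).IsQDATS} ⟨⊤, affineQuotient_top_isQDATS⟩
  refine ⟨T.affineQuotient K, toAffineQuotient K, hK, isSimulation_toAffineQuotient K, ?_⟩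
  intro W t hW ht
  have hle : K ≤ LinearMap.ker t := by
    have hinf := IsQDATS.affineQuotient_inf (isSimulation_toAffineQuotient K) ht hK hW
    rw [ker_toAffineQuotient] at hinf
    by_contra h
    exact hmin _ hinf (inf_le_left.lt_of_ne fun he => h (inf_eq_left.1 he))
  refine ⟨affineQuotientLift t hle, ⟨isSimulation_affineQuotientLift hW.1 ht hle,
    affineQuotientLift_comp t hle⟩, ?_⟩
  rintro g ⟨-, hg⟩
  refine LinearMap.ext fun x => ?_
  obtain ⟨x, rfl⟩ := toAffineQuotient_surjective _ x
  exact (LinearMap.congr_fun hg x).trans (LinearMap.congr_fun (affineQuotientLift_comp t hle) x).symm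

end TransitionSystem

/-! ## Integer coordinates -/

theorem exists_basis_integral_repr {M ι : Type*} [AddCommGroup M] [Module ℚ M]
    [FiniteDimensional ℚ M] [Fintype ι] (v : ι → M) :
    ∃ (n : ℕ) (b : Module.Basis (Fin n) ℚ M) (z : Fin n → ι → ℤ),
      ∀ i j, b.repr (v i) j = z j i := by
  let b := Module.finBasis ℚ M
  obtain ⟨N, hN, z, hz⟩ := LIA.exists_common_denominator
    (Finset.univ : Finset (Fin (Module.finrank ℚ M) × ι)) (fun x => b.repr (v x.2) x.1)
  have hN' : (N : ℚ) ≠ 0 := by positivity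
  -- Dividing the basis vectors by `N` multiplies all coordinates by `N`.
  refine ⟨_, b.unitsSMul fun _ => (Units.mk0 (N : ℚ) hN')⁻¹, fun j i => z (j, i), fun i j => ?_⟩
  rw [Module.Basis.repr_unitsSMul, inv_inv, ← hz (j, i) (Finset.mem_univ _)]
  rfl

theorem exists_integral_matrix_ker {M : Type*} [AddCommGroup M] [Module ℚ M] {m : ℕ}
    (b : Module.Basis (Fin m) ℚ M) (f : M →ₗ[ℚ] M) :
    ∃ C : Matrix (Fin m) (Fin m) ℤ, ∀ y,
      (∀ i, ∑ j, (C i j : ℚ) * b.repr y j = 0) ↔ f y = 0 := by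
  obtain ⟨N, hN, z, hz⟩ := LIA.exists_common_denominator
    (Finset.univ : Finset (Fin m × Fin m)) (fun x => b.repr (f (b x.2)) x.1)
  have hN' : (N : ℚ) ≠ 0 := by positivity
  refine ⟨fun i j => z (i, j), fun y => ?_⟩
  have h : ∀ i, ∑ j, (z (i, j) : ℚ) * b.repr y j = N * b.repr (f y) i := by
    intro i
    conv_rhs => rw [← b.sum_repr y]
    simp only [map_sum, map_smul, Finsupp.coe_finsetSum, Finset.sum_apply, Finsupp.smul_apply,
      smul_eq_mul, Finset.mul_sum]
    refine Finset.sum_congr rfl fun j _ => ?_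
    rw [← hz (i, j) (Finset.mem_univ _)]
    ring
  simp only [h, mul_eq_zero, hN', false_or]
  rw [← b.repr.map_eq_zero_iff, Finsupp.ext_iff]
  rfl

namespace LIA.QF

theorem eq_affine {X Y : Type} [Fintype X] (σ : X → Term Y) (u : Term Y) (a : X → ℤ) (d : ℤ) :
    QF (fun v : Y → ℤ => u.eval v = ∑ x, a x * (σ x).eval v + d) := by
  refine (eqZero (u.add (((Term.sum ((Finset.univ : Finset X).toList.map
    fun x => (σ x).smul (a x))).add (Term.const d)).smul (-1)))).congr fun v => ?_
  simp only [Term.eval, Term.eval_sum, List.map_map, Function.comp_def, Int.cast_id]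
  rw [Finset.sum_map_toList]
  constructor <;> intro h <;> linarith

end LIA.QF

/-! ### Orbits in ℤ(T) and their transport along simulations -/

namespace TransitionSystem

variable {T U : TransitionSystem}

theorem coe_intMap_pow (hL : T.IsLinear) (hD : T.IsDeterministic) (k : ℕ)
    (y : intSubspace hL hD) :
    ((((intMap hL hD ^ k) y : intSubspace hL hD)) : omegaSubspace hL) =
      (omegaMap hL hD ^ k) (y : omegaSubspace hL) :=
  Module.End.comp_pow_of_comp (u := (intSubspace hL hD).subtype) (LinearMap.ext fun _ => rfl) k y

/-- The property is linear in the starting vector, so it reduces to the generalized eigenvectors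
spanning ℤ(T). The functional is first extended to the ω-domain, where these live. -/
theorem intMap_pow_mem_evExp (hL : T.IsLinear) (hD : T.IsDeterministic)
    (ℓ : intSubspace hL hD →ₗ[ℚ] ℚ) (y : intSubspace hL hD) :
    (fun k => ℓ ((intMap hL hD ^ k) y)) ∈ LIA.evExp Set.univ := by
  obtain ⟨ℓ', rfl⟩ := LinearMap.exists_extend ℓ
  have key : ∀ x ∈ intSubspace hL hD,
      (fun k => ℓ' ((omegaMap hL hD ^ k) x)) ∈ LIA.evExp Set.univ := by
    intro x hx
    induction hx using Submodule.span_induction with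
    | mem x hx =>
      obtain ⟨r, -, l, h⟩ := hx
      exact LIA.gen_eigenvector_mem_evExp _ l r x h ℓ'
    | zero =>
      simp only [map_zero]
      exact zero_mem (LIA.evExp Set.univ)
    | add x y _ _ hx hy =>
      simp only [map_add]
      exact add_mem hx hy
    | smul c x _ hx =>
      simp only [map_smul]
      exact Submodule.smul_mem _ c hx
  have h := key y y.2
  simp only [← coe_intMap_pow] at h
  exact h

theorem toMatrix_intMap_pow_mem_evExp (hL : T.IsLinear) (hD : T.IsDeterministic) {q : ℕ}
    (b : Module.Basis (Fin q) ℚ (intSubspace hL hD)) (i j : Fin q) :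
    (fun k => (LinearMap.toMatrix b b (intMap hL hD) ^ k) i j) ∈ LIA.evExp Set.univ := by
  have h := intMap_pow_mem_evExp hL hD (b.coord i) (b j)
  simp only [LinearMap.toMatrix_pow, LinearMap.toMatrix_apply]
  exact h

/-- The lift intertwines the ω-maps, hence also the powers of their translates by the same integer.
-/
theorem omegaLift_mem_intSubspace (hT : T.IsLinear) (hDT : T.IsDeterministic) (hU : U.IsLinear)
    (hDU : U.IsDeterministic) (s : T.State →ₗ[ℚ] U.State) (hs : T.IsSimulation U s)
    {x : omegaSubspace hT} (hx : x ∈ intSubspace hT hDT) :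
    omegaLift hT hU s hs x ∈ intSubspace hU hDU := by
  have hle : intSubspace hT hDT ≤ (intSubspace hU hDU).comap (omegaLift hT hU s hs) := by
    refine Submodule.span_le.2 ?_
    rintro y ⟨r, hr, l, hy⟩
    refine Submodule.subset_span ⟨r, hr, l, ?_⟩
    have hc : omegaLift hT hU s hs ∘ₗ
        (omegaMap hT hDT - (l : ℚ) • (1 : Module.End ℚ (omegaSubspace hT))) =
        (omegaMap hU hDU - (l : ℚ) • (1 : Module.End ℚ (omegaSubspace hU))) ∘ₗ
          omegaLift hT hU s hs := by
      rw [LinearMap.comp_sub, LinearMap.sub_comp, omegaLift_comp_omegaMap hT hDT hU hDU,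
        LinearMap.comp_smul, LinearMap.smul_comp]
      rfl
    rw [← Module.End.comp_pow_of_comp hc, hy, map_zero]
  exact hle hx

/-- The orbit condition that is expressed by a mortal precondition: the state `(s(x), 1)` of the
homogenization of `V` lies in `ℤ(T)`, and eventually all states on its orbit are of the form
`(s(x₁), 1)` where `x₁` has an `F`-successor. -/
def EventuallyInDomain {X : Type} [Fintype X] (F : TransitionFormula X) (V : TransitionSystem)
    (hV : V.IsQDATS) (s : (X → ℚ) →ₗ[ℚ] V.State) (x : X → ℤ) : Prop :=
  ∃ y ∈ intSubspace V.homog_isLinear hV.homog_isDeterministic,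
    (y : V.homog.State) = (s (fun j => (x j : ℚ)), (1 : ℚ)) ∧
    ∀ᶠ k in atTop, ∃ x₁ x₁' : X → ℤ, F.Sat (Sum.elim x₁ x₁') ∧
      (((omegaMap V.homog_isLinear hV.homog_isDeterministic ^ k) y :
        omegaSubspace V.homog_isLinear) : V.homog.State) =
        (s (fun j => (x₁ j : ℚ)), (1 : ℚ))

theorem EventuallyInDomain.mono {X : Type} [Fintype X] {F₁ F₂ : TransitionFormula X}
    (hF : F₁.Entails F₂) {V₁ V₂ : TransitionSystem} {hV₁ : V₁.IsQDATS} {hV₂ : V₂.IsQDATS}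
    {s₁ : (X → ℚ) →ₗ[ℚ] V₁.State} {s₂ : (X → ℚ) →ₗ[ℚ] V₂.State}
    (h₁ : F₁.toTransitionSystem.IsReflection V₁ IsQDATS s₁)
    (h₂ : F₂.toTransitionSystem.IsReflection V₂ IsQDATS s₂) {x : X → ℤ}
    (h : EventuallyInDomain F₁ V₁ hV₁ s₁ x) : EventuallyInDomain F₂ V₂ hV₂ s₂ x := by
  -- Here the entailment enters: each transition of `F₁` is one of `F₂`. The reflection of `F₁` then
  -- yields `u` with `u ∘ s₁ = s₂`.
  have hsim : F₁.toTransitionSystem.IsSimulation V₂ s₂ := by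
    rintro _ _ ⟨v, v', he, hv⟩
    exact h₂.2.1 _ _ ⟨v, v', he, hF _ hv⟩
  obtain ⟨u, ⟨hu, hus⟩, -⟩ := h₁.2.2 V₂ s₂ hV₂ hsim
  have hus' : ∀ x : X → ℚ, u (s₁ x) = s₂ x := fun x => LinearMap.congr_fun hus x
  obtain ⟨y, hy, hyx, hk⟩ := h
  have hc := omegaLift_comp_omegaMap V₁.homog_isLinear hV₁.homog_isDeterministic
    V₂.homog_isLinear hV₂.homog_isDeterministic _ hu.homog
  refine ⟨omegaLift V₁.homog_isLinear V₂.homog_isLinear _ hu.homog y,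
    omegaLift_mem_intSubspace _ _ _ _ _ _ hy, ?_, ?_⟩
  · change homogMap u (y : V₁.homog.State) = _
    rw [hyx, homogMap_apply, hus']
  · filter_upwards [hk] with k hk
    obtain ⟨x₁, x₁', hx₁, he⟩ := hk
    refine ⟨x₁, x₁', hF _ hx₁, ?_⟩
    rw [← Module.End.comp_pow_of_comp hc]
    change homogMap u (((omegaMap V₁.homog_isLinear hV₁.homog_isDeterministic ^ k) y :
        omegaSubspace V₁.homog_isLinear) : V₁.homog.State) = _
    rw [he, homogMap_apply, hus']

end TransitionSystem

open TransitionSystem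

/-! ## Existence of mortal preconditions -/

theorem exists_mortalPreconditionRun {X : Type} [Fintype X] (F : TransitionFormula X) :
    Nonempty (MortalPreconditionRun F) := by
  classical
  obtain ⟨V, s, hVs⟩ := F.toTransitionSystem.exists_isReflection
  let s' : (X → ℚ) →ₗ[ℚ] V.State := s
  have hL := V.homog_isLinear
  have hD := hVs.1.homog_isDeterministic
  -- The map t(x) = (s(x), 1) is integral once (0, 1) and the images (s(eⱼ), 0) of the unit vectors
  -- have integer coordinates.
  obtain ⟨m, b, z, hz⟩ := exists_basis_integral_repr
    (fun o : Option X => (o.elim ((0 : V.State), (1 : ℚ))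
      (fun j => (s' (Pi.single j 1), (0 : ℚ))) : V.homog.State))
  have ht : ∀ (x : X → ℚ) (i : Fin m), b.repr (s' x, (1 : ℚ)) i =
      ∑ j, (z i (some j) : ℚ) * x j + (z i none : ℚ) := by
    intro x i
    let f : V.State × ℚ →ₗ[ℚ] ℚ := b.coord i
    have hf : ∀ j, f (s' (Pi.single j 1), 0) = z i (some j) := fun j => hz (some j) i
    have hf0 : f (0, 1) = z i none := hz none i
    have hx : (s' x, (1 : ℚ)) =
        ∑ j, x j • ((s' (Pi.single j 1), (0 : ℚ)) : V.State × ℚ) + ((0 : V.State), (1 : ℚ)) := by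
      refine Prod.ext ?_ ?_
      · conv_lhs => rw [pi_eq_sum_univ' x]
        simp only [map_sum, map_smul, Prod.fst_add, Prod.fst_sum, Prod.smul_fst, add_zero]
      · simp [Prod.snd_sum]
    change f (s' x, 1) = _
    rw [hx, map_add, map_sum, hf0]
    simp only [map_smul, hf, smul_eq_mul, mul_comm]
  let ι : intSubspace hL hD →ₗ[ℚ] V.homog.State :=
    (omegaSubspace hL).subtype ∘ₗ (intSubspace hL hD).subtype
  obtain ⟨π, hπ⟩ := ι.exists_leftInverse_of_injective
    (LinearMap.ker_eq_bot.2 (Subtype.val_injective.comp Subtype.val_injective))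
  -- Integrality of p is achieved by rescaling the basis of ℤ(T) alone, so the coordinates of t stay
  -- integral.
  obtain ⟨q, c, p, hp⟩ := exists_basis_integral_repr (fun j => π (b j))
  -- Since `π` is a left inverse of `ι`, the kernel of `id - ι ∘ π` is the range of `ι`, that is,
  -- ℤ(T).
  obtain ⟨C, hC⟩ := exists_integral_matrix_ker b (LinearMap.id - ι ∘ₗ π)
  have hp_eq : ∀ (y : intSubspace hL hD) (i : Fin q),
      ∑ j, (p i j : ℚ) * b.repr (y : omegaSubspace hL).1 j = c.repr y i := by
    intro y i
    have hy : π (ι y) = y := LinearMap.congr_fun hπ y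
    conv_rhs => rw [← hy, ← b.sum_repr (ι y)]
    simp only [map_sum, map_smul, Finsupp.coe_finsetSum, Finset.sum_apply, Finsupp.smul_apply,
      smul_eq_mul, hp, mul_comm]
    rfl
  have hC_eq : ∀ y : V.homog.State, (∀ i, ∑ j, (C i j : ℚ) * b.repr y j = 0) ↔
      ∃ y' : intSubspace hL hD, (y' : omegaSubspace hL).1 = y := by
    intro y
    rw [hC, LinearMap.sub_apply, sub_eq_zero]
    constructor
    · intro h
      exact ⟨π y, h.symm⟩
    · rintro ⟨y', rfl⟩
      exact congrArg ι (LinearMap.congr_fun hπ y').symm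
  let tM : Matrix (Fin m) X ℤ := fun i j => z i (some j)
  let tV : Fin m → ℤ := fun i => z i none
  let pM : Matrix (Fin q) (Fin m) ℤ := p
  have hqf : LIA.QF (fun w : Fin q → ℤ => ∃ x x' : X → ℤ, F.Sat (Sum.elim x x') ∧
      (∀ i, w i = (pM *ᵥ (tM *ᵥ x + tV)) i) ∧ C *ᵥ (tM *ᵥ x + tV) = 0) := by
    have h1 : LIA.QF (fun v : Fin q ⊕ (X ⊕ X) → ℤ => F.Sat (v ∘ Sum.inr)) :=
      (LIA.QF.of_formula F).subst (fun i => LIA.Term.var (Sum.inr i))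
    have h2 : ∀ i, LIA.QF (fun v : Fin q ⊕ (X ⊕ X) → ℤ =>
        v (Sum.inl i) = (pM *ᵥ (tM *ᵥ (fun x => v (Sum.inr (Sum.inl x))) + tV)) i) := by
      intro i
      refine (LIA.QF.eq_affine (fun x : X => LIA.Term.var (Sum.inr (Sum.inl x)))
        (LIA.Term.var (Sum.inl i)) (fun x => (pM * tM) i x) ((pM *ᵥ tV) i)).congr fun v => ?_
      rw [Matrix.mulVec_add, Matrix.mulVec_mulVec]
      rfl
    have h3 : ∀ i, LIA.QF (fun v : Fin q ⊕ (X ⊕ X) → ℤ =>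
        (C *ᵥ (tM *ᵥ (fun x => v (Sum.inr (Sum.inl x))) + tV)) i = 0) := by
      intro i
      refine (LIA.QF.eq_affine (fun x : X => LIA.Term.var (Sum.inr (Sum.inl x)))
        (LIA.Term.const 0) (fun x => (C * tM) i x) ((C *ᵥ tV) i)).congr fun v => ?_
      rw [Matrix.mulVec_add, Matrix.mulVec_mulVec]
      exact eq_comm
    refine ((h1.and ((LIA.QF.finite_all h2).and (LIA.QF.finite_all h3))).ex_finite (X ⊕ X)).congr
      fun w => ?_
    constructor
    · rintro ⟨y, hy, hy', hy''⟩
      refine ⟨y ∘ Sum.inl, y ∘ Sum.inr, ?_, hy', funext hy''⟩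
      rw [Sum.elim_comp_inl_inr]
      exact hy
    · rintro ⟨x, x', hx, hx', hx''⟩
      exact ⟨Sum.elim x x', hx, hx', fun i => congrFun hx'' i⟩
  obtain ⟨G, H, hG, hH, N, hN⟩ := LIA.exists_isCharSeq
    (toMatrix_intMap_pow_mem_evExp hL hD c) hqf
  refine ⟨⟨V, s', hVs, m, b, tM, tV, ht, q, c, pM, hp_eq, m, C, hC_eq, G, fun w => ?_, H, hH, N,
    hN⟩⟩
  rw [hG]
  constructor
  · rintro ⟨w', hw, x, x', hx, hx', hx''⟩
    exact ⟨x, x', hx, fun i => by rw [hw, hx'], hx''⟩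
  · rintro ⟨x, x', hx, hx', hx''⟩
    exact ⟨_, hx', x, x', hx, fun i => rfl, hx''⟩

/-! ## Semantics of mortal preconditions -/

namespace MortalPreconditionRun

variable {X : Type} [Fintype X] {F : TransitionFormula X} (R : MortalPreconditionRun F)

theorem eval_tTerm (i : Fin R.m) (v : X → ℤ) :
    (R.tTerm i).eval v = (R.tMat *ᵥ v + R.tVec) i := by
  simp only [tTerm, LIA.Term.eval, LIA.Term.eval_sum, List.map_map, Function.comp_def, Int.cast_id]
  rw [Finset.sum_map_toList]
  rfl

theorem eval_ptTerm (i : Fin R.q) (v : X → ℤ) :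
    (R.ptTerm i).eval v = (R.pMat *ᵥ (R.tMat *ᵥ v + R.tVec)) i := by
  simp only [ptTerm, LIA.Term.eval_sum, List.map_ofFn, List.sum_ofFn, Function.comp_def,
    LIA.Term.eval, eval_tTerm, Int.cast_id]
  rfl

theorem eval_ctTerm (i : Fin R.r) (v : X → ℤ) :
    (R.ctTerm i).eval v = (R.C *ᵥ (R.tMat *ᵥ v + R.tVec)) i := by
  simp only [ctTerm, LIA.Term.eval_sum, List.map_ofFn, List.sum_ofFn, Function.comp_def,
    LIA.Term.eval, eval_tTerm, Int.cast_id]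
  rfl

theorem repr_eq (x : X → ℤ) (i : Fin R.m) :
    R.stateBasis.repr (R.s (fun j => (x j : ℚ)), (1 : ℚ)) i =
      ((R.tMat *ᵥ x + R.tVec) i : ℤ) := by
  rw [R.t_eq]
  simp [Matrix.mulVec, dotProduct]

theorem C_mulVec_eq_zero_iff (x : X → ℤ) : R.C *ᵥ (R.tMat *ᵥ x + R.tVec) = 0 ↔
    ∃ y' : intSubspace R.V.homog_isLinear R.isReflection.1.homog_isDeterministic,
      (y' : omegaSubspace R.V.homog_isLinear).1 = (R.s (fun j => (x j : ℚ)), (1 : ℚ)) := by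
  refine Iff.trans ?_ (R.C_eq _)
  rw [funext_iff]
  refine forall_congr' fun i => ?_
  simp only [R.repr_eq]
  rw [← Int.cast_inj (α := ℚ)]
  simp [Matrix.mulVec, dotProduct]

theorem intBasis_repr_eq {x : X → ℤ}
    {y : intSubspace R.V.homog_isLinear R.isReflection.1.homog_isDeterministic}
    (h : (y : omegaSubspace R.V.homog_isLinear).1 = (R.s (fun j => (x j : ℚ)), (1 : ℚ)))
    (i : Fin R.q) :
    R.intBasis.repr y i = ((R.pMat *ᵥ (R.tMat *ᵥ x + R.tVec)) i : ℤ) := by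
  rw [← R.p_eq, h]
  simp only [R.repr_eq]
  simp [Matrix.mulVec, dotProduct]

/-- The right-hand side mentions only the reflection, not the coordinates, p, C, G or H. This is
what makes outputs of different runs comparable. -/
theorem sat_output_iff (v : X → ℤ) :
    R.output.Sat v ↔ ¬ EventuallyInDomain F R.V R.isReflection.1 R.s v := by
  set hL := R.V.homog_isLinear
  set hD := R.isReflection.1.homog_isDeterministic
  have hC : (LIA.Formula.conj (List.ofFn (fun i => LIA.Formula.eqZero (R.ctTerm i)))).Holds v ↔
      R.C *ᵥ (R.tMat *ᵥ v + R.tVec) = 0 := by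
    simp only [LIA.Formula.holds_conj, List.forall_mem_ofFn_iff, LIA.Formula.holds_eqZero,
      eval_ctTerm, funext_iff, Pi.zero_apply]
  have hH : (LIA.Formula.conj (List.ofFn (fun i : Fin (R.P + 1) =>
      (R.H i).subst R.ptTerm))).Holds v ↔ ∀ᶠ k in atTop,
        R.G.Holds (LinearMap.toMatrix R.intBasis R.intBasis (intMap hL hD) ^ k *ᵥ
          fun i => (((R.pMat *ᵥ (R.tMat *ᵥ v + R.tVec)) i : ℤ) : ℚ)) := by
    rw [← R.isCharSeq.forall_holds_iff R.hasPeriod]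
    simp only [LIA.Formula.holds_conj, List.forall_mem_ofFn_iff, LIA.Formula.holds_subst,
      eval_ptTerm]
  have hout : R.output.Sat v ↔ ¬ (_ ∧ _) := not_congr (and_congr hH hC)
  rw [hout, not_iff_not, C_mulVec_eq_zero_iff, and_comm]
  have key : ∀ y : intSubspace hL hD,
      (y : omegaSubspace hL).1 = (R.s (fun j => (v j : ℚ)), (1 : ℚ)) → ∀ k,
      (R.G.Holds (LinearMap.toMatrix R.intBasis R.intBasis (intMap hL hD) ^ k *ᵥ
          fun i => (((R.pMat *ᵥ (R.tMat *ᵥ v + R.tVec)) i : ℤ) : ℚ)) ↔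
        ∃ x₁ x₁' : X → ℤ, F.Sat (Sum.elim x₁ x₁') ∧
          (((omegaMap hL hD ^ k) y : omegaSubspace hL) : R.V.homog.State) =
            (R.s (fun j => (x₁ j : ℚ)), (1 : ℚ))) := by
    intro y hy k
    have hw : (LinearMap.toMatrix R.intBasis R.intBasis (intMap hL hD) ^ k *ᵥ
        fun i => (((R.pMat *ᵥ (R.tMat *ᵥ v + R.tVec)) i : ℤ) : ℚ)) =
        R.intBasis.repr ((intMap hL hD ^ k) y) := by
      rw [LinearMap.toMatrix_pow, ← LinearMap.toMatrix_mulVec_repr R.intBasis R.intBasis]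
      congr 1
      exact funext fun i => (R.intBasis_repr_eq hy i).symm
    rw [hw, R.G_eq]
    refine exists_congr fun x₁ => exists_congr fun x₁' => and_congr_right fun _ => ?_
    rw [C_mulVec_eq_zero_iff, ← coe_intMap_pow]
    constructor
    · rintro ⟨h1, y₁, hy₁⟩
      -- C t(x₁) = 0 places t(x₁) in ℤ(T), where p is the identity; equal p-coordinates therefore
      -- mean equal states.
      have : (intMap hL hD ^ k) y = y₁ := by
        refine R.intBasis.repr.injective (Finsupp.ext fun i => ?_)
        rw [h1, R.intBasis_repr_eq hy₁]
      rw [this, hy₁]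
    · intro h
      exact ⟨fun i => R.intBasis_repr_eq h i, _, h⟩
  constructor
  · rintro ⟨⟨y, hy⟩, h⟩
    exact ⟨y, y.2, hy, h.mono fun k hk => (key y hy k).1 hk⟩
  · rintro ⟨y, hyI, hy, h⟩
    exact ⟨⟨⟨y, hyI⟩, hy⟩, h.mono fun k hk => (key ⟨y, hyI⟩ hy k).2 hk⟩

end MortalPreconditionRun

theorem mainTheorem7 {X : Type} [Fintype X] :
    (∀ F : TransitionFormula X, ∃ M : LIA.Formula X, IsMortalPrecondition F M) ∧
      ∀ F₁ F₂ : TransitionFormula X, F₁.Entails F₂ →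
        ∀ M₁ M₂ : LIA.Formula X, IsMortalPrecondition F₁ M₁ → IsMortalPrecondition F₂ M₂ →
          M₂.Entails M₁ := by
  refine ⟨fun F => ?_, ?_⟩
  · obtain ⟨R⟩ := exists_mortalPreconditionRun F
    exact ⟨R.output, R, rfl⟩
  · rintro F₁ F₂ hF _ _ ⟨R₁, rfl⟩ ⟨R₂, rfl⟩ v hv
    rw [R₁.sat_output_iff]
    rw [R₂.sat_output_iff] at hv
    exact fun h => hv (h.mono hF R₁.isReflection R₂.isReflection)
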